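/- Let $\Psi\mathrm{Dif}_1$ be the associative algebra of formal pseudo-differential operators $\sum_{i\le N}a_i(x)\,\partial^i$ with $a_i\in\mathbb C[x,x^{-1}]$, where $\partial=d/dx$, and let $\operatorname{res}$ be the noncommutative residue, that is, the coefficient at $x^{-1}\partial^{-1}$. Put $D_1=\operatorname{ad}(\ln\partial)$, $D_2=\operatorname{ad}(\ln x)$, that is, $$D_1(a\partial^i)=\sum_{n\ge1}\tfrac{(-1)^{n-1}}{n}a^{(n)}\partial^{i-n},\qquad D_2(a\partial^i)=-\sum_{n\ge1}\tbinom in(-1)^{n-1}(n-1)!\,a\,x^{-n}\partial^{i-n},$$ and $Q=\sum_{n\ge1}\frac{(n-1)!}{n}x^{-n}\partial^{-n}$, so that $[D_1,D_2]=\operatorname{ad}Q$. Let these act entrywise on infinite matrices over $\Psi\mathrm{Dif}_1$ ($Q$ as $\mathrm{Id}\otimes Q$), let $\operatorname{Tr}$ of such a matrix be the residue of its diagonal sum, and for $k\ge1$ let $\Psi_{2k+1}$ be the lifting cochain $$\Psi_{2k+1}(A_1,\dots,A_{2k+1})=\operatorname{Alt}_A\operatorname{Tr}(Q A_1\cdots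 A_{2k+1})+\sum_{s\ge1}w_s\operatorname{Alt}_{A,D}\operatorname{Tr}(D_1A_1\cdot A_2\cdots A_{2s-1}\cdot D_2A_{2s}\cdot A_{2s+1}\cdots A_{2k+1}),$$ where $w_s=1$ if $2s\le k+1$, $w_s=\frac12$ if $2s=k+2$, $w_s=0$ otherwise, and $\operatorname{Alt}$ is the signed sum over all permutations (of the $A_i$, respectively of the $A_i$ and of $D_1,D_2$), without normalizing factor; it is evaluated on row- and column-finite infinite matrices, at least one of which has finitely many nonzero entries. Let $\mathfrak{gl}_\infty^{\mathrm{fin}}$ be the Lie algebra of infinite complex matrices with finitely many nonzero entries, embedded by $A\mapsto A\otimes1$. Then for every $k\ge1$ the cochain $$(A_1,\dots,A_{2k-1})\mapsto\Psi_{2k+1}(\mathrm{Id}\otimes\partial,\ \mathrm{Id}\otimes x^2\partial,\ A_1\otimes1,\dots,A_{2k-1}\otimes1)$$ has a nonzero value on some $(2k-1)$-cycle $\sum_iA_1^{(i)}\wedge\dots\wedge A_{2k-1}^{(i)}$ of the Chevalley–Eilenberg complex of $\mathfrak{gl}_\infty^{\mathrm{fin}}$ with trivial coefficients. More precisely, its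 value on every $(2k-1)$-chain $\sum_iA_1^{(i)}\wedge\dots\wedge A_{2k-1}^{(i)}$, in particular on every cycle, is $$-(2k+1)\cdot\operatorname{tr}\Bigl(\sum_i\operatorname{Alt}\bigl(A_1^{(i)}\cdots A_{2k-1}^{(i)}\bigr)\Bigr).$$ For $k=1$ one has $\Psi_3(\mathrm{Id}\otimes\partial,\mathrm{Id}\otimes x^2\partial,E_{11}\otimes1)=-3$. -/

import Mathlib

open scoped LaurentPolynomial

noncomputable section

namespace PsiDif

/-- `d/dx` on Laurent polynomials in `x`, as a linear map: `x ^ n ↦ n x ^ (n - 1)`. -/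
def dxLin : ℂ[T;T⁻¹] →ₗ[ℂ] ℂ[T;T⁻¹] :=
  (Finsupp.lsum ℂ fun n : ℤ =>
      LinearMap.toSpanSingleton ℂ ℂ[T;T⁻¹] (AddMonoidAlgebra.single (n - 1) (n : ℂ))) ∘ₗ
    (AddMonoidAlgebra.coeffLinearEquiv ℂ : ℂ[T;T⁻¹] ≃ₗ[ℂ] (ℤ →₀ ℂ)).toLinearMap

theorem dxLin_single (n : ℤ) (a : ℂ) :
    dxLin (AddMonoidAlgebra.single n a) = AddMonoidAlgebra.single (n - 1) (a * n) := by
  simp only [dxLin, LinearMap.comp_apply, LinearEquiv.coe_coe,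
    AddMonoidAlgebra.coeffLinearEquiv_apply, AddMonoidAlgebra.coeff_single]
  rw [Finsupp.lsum_single, LinearMap.toSpanSingleton_apply, AddMonoidAlgebra.smul_single,
    smul_eq_mul]

/-- `d/dx` as a derivation of the algebra of Laurent polynomials in `x`. -/
def dx : Derivation ℂ ℂ[T;T⁻¹] ℂ[T;T⁻¹] :=
  Derivation.mk' dxLin (by
    intro f g
    simp only [smul_eq_mul]
    induction f using AddMonoidAlgebra.induction_linear with
    | zero => simp
    | add f₁ f₂ h₁ h₂ => simp only [add_mul, map_add, h₁, h₂, mul_add]; ring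
    | single m a =>
      induction g using AddMonoidAlgebra.induction_linear with
      | zero => simp
      | add f₁ f₂ h₁ h₂ => simp only [mul_add, map_add, h₁, h₂, add_mul]; ring
      | single n b =>
        rw [AddMonoidAlgebra.single_mul_single, dxLin_single, dxLin_single, dxLin_single,
          AddMonoidAlgebra.single_mul_single, AddMonoidAlgebra.single_mul_single,
          show m + (n - 1) = m + n - 1 by ring, show n + (m - 1) = m + n - 1 by ring,
          ← AddMonoidAlgebra.single_add]
        congr 1
        push_cast
        ring)

theorem dx_iterate_add (n : ℕ) (a b : ℂ[T;T⁻¹]) : dx^[n] (a + b) = dx^[n] a + dx^[n] b :=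
  iterate_map_add dx n a b

theorem dx_iterate_mul (n : ℕ) (a b : ℂ[T;T⁻¹]) :
    dx^[n] (a * b) =
      ∑ ij ∈ Finset.HasAntidiagonal.antidiagonal n, n.choose ij.1 • (dx^[ij.1] a * dx^[ij.2] b) := by
  induction n with
  | zero => simp
  | succ n ih =>
    rw [Finset.sum_antidiagonal_choose_succ_nsmul (fun i j => dx^[i] a * dx^[j] b) n]
    simp only [Function.iterate_succ_apply', ih, map_sum, map_nsmul, Derivation.leibniz, smul_add,
      Finset.sum_add_distrib, smul_eq_mul]
    congr 1
    refine Finset.sum_congr rfl fun ⟨i, j⟩ hij ↦ ?_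
    rw [n.choose_symm_of_eq_add (Finset.HasAntidiagonal.mem_antidiagonal.1 hij).symm, mul_comm]

end PsiDif

open PsiDif

/-- A formal pseudo-differential operator on the circle: a formal series `∑ i, aᵢ(x) ∂ ^ i` with
`aᵢ` a Laurent polynomial in `x` and `aᵢ = 0` for all large `i`. -/
@[ext]
structure PsiDif where
  coeff : ℤ → ℂ[T;T⁻¹]
  bounded : ∃ N : ℤ, ∀ i, N < i → coeff i = 0

namespace PsiDif

theorem coeff_injective : Function.Injective PsiDif.coeff := fun _ _ h => PsiDif.ext h

instance : Zero PsiDif := ⟨⟨0, 0, fun _ _ => rfl⟩⟩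

instance : Add PsiDif :=
  ⟨fun P Q => ⟨P.coeff + Q.coeff, by
    obtain ⟨N, hN⟩ := P.bounded
    obtain ⟨M, hM⟩ := Q.bounded
    exact ⟨max N M, fun i hi => by
      simp [hN i (lt_of_le_of_lt (le_max_left _ _) hi),
        hM i (lt_of_le_of_lt (le_max_right _ _) hi)]⟩⟩⟩

instance : Neg PsiDif :=
  ⟨fun P => ⟨-P.coeff, by
    obtain ⟨N, hN⟩ := P.bounded
    exact ⟨N, fun i hi => by simp [hN i hi]⟩⟩⟩

instance : Sub PsiDif :=
  ⟨fun P Q => ⟨P.coeff - Q.coeff, by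
    obtain ⟨N, hN⟩ := P.bounded
    obtain ⟨M, hM⟩ := Q.bounded
    exact ⟨max N M, fun i hi => by
      simp [hN i (lt_of_le_of_lt (le_max_left _ _) hi),
        hM i (lt_of_le_of_lt (le_max_right _ _) hi)]⟩⟩⟩

instance {S : Type*} [Monoid S] [DistribMulAction S ℂ[T;T⁻¹]] : SMul S PsiDif :=
  ⟨fun c P => ⟨c • P.coeff, by
    obtain ⟨N, hN⟩ := P.bounded
    exact ⟨N, fun i hi => by simp [hN i hi]⟩⟩⟩

instance : AddCommGroup PsiDif :=
  coeff_injective.addCommGroup _ rfl (fun _ _ => rfl) (fun _ => rfl) (fun _ _ => rfl)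
    (fun _ _ => rfl) (fun _ _ => rfl)

/-- The coefficients as an additive map. -/
def coeffHom : PsiDif →+ (ℤ → ℂ[T;T⁻¹]) where
  toFun := coeff
  map_zero' := rfl
  map_add' _ _ := rfl

instance : Module ℂ PsiDif :=
  coeff_injective.module ℂ coeffHom fun _ _ => rfl

/-- The operator `a(x) ∂ ^ n`. -/
def monomial (n : ℤ) (a : ℂ[T;T⁻¹]) : PsiDif :=
  ⟨Pi.single n a, n, fun _ hi => Pi.single_eq_of_ne (ne_of_gt hi) _⟩

instance : One PsiDif := ⟨monomial 0 1⟩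

/-- The contribution of `(a ∂ ^ i) (b ∂ ^ j)` to the coefficient at `∂ ^ m`. -/
def term (i j m : ℤ) (a b : ℂ[T;T⁻¹]) : ℂ[T;T⁻¹] :=
  if m ≤ i + j then
    Ring.choose i (i + j - m).toNat • (a * dx^[(i + j - m).toNat] b) else 0

theorem term_zero_left (i j m : ℤ) (b : ℂ[T;T⁻¹]) : term i j m 0 b = 0 := by
  simp [term]

theorem term_zero_right (i j m : ℤ) (a : ℂ[T;T⁻¹]) : term i j m a 0 = 0 := by
  simp [term, iterate_map_zero]

theorem term_add_left (i j m : ℤ) (a a' b : ℂ[T;T⁻¹]) :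
    term i j m (a + a') b = term i j m a b + term i j m a' b := by
  unfold term; split_ifs <;> simp [add_mul]

theorem term_add_right (i j m : ℤ) (a b b' : ℂ[T;T⁻¹]) :
    term i j m a (b + b') = term i j m a b + term i j m a b' := by
  unfold term; split_ifs <;> simp [mul_add, iterate_map_add]

theorem term_sum_left {ι : Type*} (s : Finset ι) (i j m : ℤ) (f : ι → ℂ[T;T⁻¹]) (b : ℂ[T;T⁻¹]) :
    term i j m (∑ t ∈ s, f t) b = ∑ t ∈ s, term i j m (f t) b :=
  map_sum (AddMonoidHom.mk' (fun a => term i j m a b) fun _ _ => term_add_left ..) f s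

theorem term_sum_right {ι : Type*} (s : Finset ι) (i j m : ℤ) (a : ℂ[T;T⁻¹]) (f : ι → ℂ[T;T⁻¹]) :
    term i j m a (∑ t ∈ s, f t) = ∑ t ∈ s, term i j m a (f t) :=
  map_sum (AddMonoidHom.mk' (fun b => term i j m a b) fun _ _ => term_add_right ..) f s

/-- The coefficient at `∂ ^ m` of the product is
`∑ᵢ ∑ₙ (i choose n) aᵢ bⱼ⁽ⁿ⁾` with `i + j - n = m`, from
`∂ ^ i ∘ b = ∑ₙ (i choose n) b⁽ⁿ⁾ ∂ ^ (i - n)`; all but finitely many terms vanish. -/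
def mulCoeff (P Q : PsiDif) (m : ℤ) : ℂ[T;T⁻¹] :=
  ∑ᶠ p : ℤ × ℕ,
    Ring.choose p.1 p.2 • (P.coeff p.1 * dx^[p.2] (Q.coeff (m - p.1 + p.2)))

theorem mulCoeff_eq_sum (P Q : PsiDif) (m : ℤ) (I J : Finset ℤ)
    (h : ∀ i j, m ≤ i + j → P.coeff i ≠ 0 → Q.coeff j ≠ 0 → i ∈ I ∧ j ∈ J) :
    mulCoeff P Q m = ∑ i ∈ I, ∑ j ∈ J, term i j m (P.coeff i) (Q.coeff j) := by
  classical
  set f : ℤ × ℕ → ℂ[T;T⁻¹] := fun p =>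
    Ring.choose p.1 p.2 • (P.coeff p.1 * dx^[p.2] (Q.coeff (m - p.1 + p.2))) with hf
  set s : Finset (ℤ × ℕ) := ((I ×ˢ J).filter fun p => m ≤ p.1 + p.2).image
    fun p => (p.1, (p.1 + p.2 - m).toNat) with hs
  have hsupp : Function.support f ⊆ s := by
    rintro ⟨i, n⟩ hp
    have h1 : P.coeff i ≠ 0 := by
      intro h0; apply hp; simp [hf, h0]
    have h2 : Q.coeff (m - i + n) ≠ 0 := by
      intro h0; apply hp; simp [hf, h0, iterate_map_zero]
    have h3 := h i (m - i + n) (by omega) h1 h2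
    simp only [hs, Finset.coe_image, Set.mem_image, Finset.mem_coe, Finset.mem_filter,
      Finset.mem_product]
    refine ⟨(i, m - i + n), ⟨h3, by simp only; omega⟩, ?_⟩
    simp only [Prod.mk.injEq, true_and]
    omega
  rw [mulCoeff, finsum_eq_sum_of_support_subset f hsupp, hs, Finset.sum_image, Finset.sum_filter,
    Finset.sum_product]
  · refine Finset.sum_congr rfl fun i _ => Finset.sum_congr rfl fun j _ => ?_
    unfold term
    split_ifs with hij
    · have : m - i + ((i + j - m).toNat : ℤ) = j := by omega
      simp only [hf, this]
    · rfl
  · rintro ⟨i, j⟩ hij ⟨i', j'⟩ hij' heq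
    simp only [Finset.coe_filter, Set.mem_ofPred_eq] at hij hij'
    simp only [Prod.mk.injEq] at heq ⊢
    obtain ⟨rfl, h2⟩ := heq
    exact ⟨rfl, by omega⟩

theorem mulCoeff_eq_zero (P Q : PsiDif) (N M : ℤ) (hN : ∀ i, N < i → P.coeff i = 0)
    (hM : ∀ i, M < i → Q.coeff i = 0) (m : ℤ) (hm : N + M < m) : mulCoeff P Q m = 0 := by
  rw [mulCoeff_eq_sum P Q m ∅ ∅]
  · simp
  · intro i j hij hi hj
    have h1 : i ≤ N := not_lt.1 fun h => hi (hN i h)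
    have h2 : j ≤ M := not_lt.1 fun h => hj (hM j h)
    omega

theorem mulCoeff_eq_box (P Q : PsiDif) (N M : ℤ) (hN : ∀ i, N < i → P.coeff i = 0)
    (hM : ∀ i, M < i → Q.coeff i = 0) (m a b : ℤ) (ha : a ≤ m - M) (hb : b ≤ m - N) :
    mulCoeff P Q m = ∑ i ∈ Finset.Icc a N, ∑ j ∈ Finset.Icc b M,
      term i j m (P.coeff i) (Q.coeff j) := by
  apply mulCoeff_eq_sum
  intro i j hij hi hj
  have h1 : i ≤ N := not_lt.1 fun h => hi (hN i h)
  have h2 : j ≤ M := not_lt.1 fun h => hj (hM j h)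
  simp only [Finset.mem_Icc]
  omega

/-- Composition of pseudo-differential operators. -/
instance : Mul PsiDif :=
  ⟨fun P Q => ⟨mulCoeff P Q, by
    obtain ⟨N, hN⟩ := P.bounded
    obtain ⟨M, hM⟩ := Q.bounded
    exact ⟨N + M, fun m hm => mulCoeff_eq_zero P Q N M hN hM m hm⟩⟩⟩

theorem sum_term_left (i j k m : ℤ) (a b c : ℂ[T;T⁻¹]) (L : Finset ℤ)
    (hL : Finset.Icc (m - k) (i + j) ⊆ L) :
    ∑ l ∈ L, term l k m (term i j l a b) c =
      if m ≤ i + j + k then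
        ∑ nr ∈ Finset.HasAntidiagonal.antidiagonal (i + j + k - m).toNat,
          (Ring.choose i nr.1 * Ring.choose (i + j - nr.1) nr.2) •
            (a * dx^[nr.1] b * dx^[nr.2] c) else 0 := by
  classical
  rw [← Finset.sum_subset hL]
  · split_ifs with h
    · symm
      refine Finset.sum_bij (fun nr _ => i + j - nr.1) ?_ ?_ ?_ ?_
      · rintro ⟨n, r⟩ hnr
        simp only [Finset.HasAntidiagonal.mem_antidiagonal] at hnr
        simp only [Finset.mem_Icc]; omega
      · rintro ⟨n, r⟩ hnr ⟨n', r'⟩ hnr' heq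
        simp only [Finset.HasAntidiagonal.mem_antidiagonal] at hnr hnr' heq
        simp only [Prod.mk.injEq]; omega
      · intro l hl
        simp only [Finset.mem_Icc] at hl
        refine ⟨((i + j - l).toNat, (l + k - m).toNat), ?_, ?_⟩
        · simp only [Finset.HasAntidiagonal.mem_antidiagonal]; omega
        · simp only; omega
      · rintro ⟨n, r⟩ hnr
        simp only [Finset.HasAntidiagonal.mem_antidiagonal] at hnr
        have h1 : (i + j - (i + j - (n : ℤ))).toNat = n := by omega
        have h2 : (i + j - (n : ℤ) + k - m).toNat = r := by omega
        simp only [term]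
        rw [if_pos (by omega), if_pos (by omega), h1, h2, smul_mul_assoc, smul_smul, mul_comm]
    · rw [Finset.Icc_eq_empty (by omega), Finset.sum_empty]
  · intro l _ hl
    simp only [Finset.mem_Icc, not_and_or, not_le] at hl
    rcases hl with hl | hl
    · rw [term, if_neg (by omega)]
    · rw [term.eq_def i j, if_neg (by omega), term_zero_left]

theorem sum_term_right (i j k m : ℤ) (a b c : ℂ[T;T⁻¹]) (L : Finset ℤ)
    (hL : Finset.Icc (m - i) (j + k) ⊆ L) :
    ∑ l ∈ L, term i l m a (term j k l b c) =
      if m ≤ i + j + k then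
        ∑ qt ∈ Finset.HasAntidiagonal.antidiagonal (i + j + k - m).toNat,
          (Ring.choose i qt.2 * Ring.choose j qt.1) •
            (a * dx^[qt.2] (b * dx^[qt.1] c)) else 0 := by
  classical
  rw [← Finset.sum_subset hL]
  · split_ifs with h
    · symm
      refine Finset.sum_bij (fun qt _ => j + k - qt.1) ?_ ?_ ?_ ?_
      · rintro ⟨n, r⟩ hnr
        simp only [Finset.HasAntidiagonal.mem_antidiagonal] at hnr
        simp only [Finset.mem_Icc]; omega
      · rintro ⟨n, r⟩ hnr ⟨n', r'⟩ hnr' heq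
        simp only [Finset.HasAntidiagonal.mem_antidiagonal] at hnr hnr' heq
        simp only [Prod.mk.injEq]; omega
      · intro l hl
        simp only [Finset.mem_Icc] at hl
        refine ⟨((j + k - l).toNat, (i + l - m).toNat), ?_, ?_⟩
        · simp only [Finset.HasAntidiagonal.mem_antidiagonal]; omega
        · simp only; omega
      · rintro ⟨n, r⟩ hnr
        simp only [Finset.HasAntidiagonal.mem_antidiagonal] at hnr
        have h1 : (j + k - (j + k - (n : ℤ))).toNat = n := by omega
        have h2 : (i + (j + k - (n : ℤ)) - m).toNat = r := by omega
        simp only [term]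
        rw [if_pos (by omega), if_pos (by omega), h1, h2]
        have : ∀ (z : ℤ) (u : ℂ[T;T⁻¹]), dx^[r] (z • u) = z • dx^[r] u := fun z u =>
          iterate_map_zsmul dx r u z
        rw [this, mul_smul_comm, smul_smul]
    · rw [Finset.Icc_eq_empty (by omega), Finset.sum_empty]
  · intro l _ hl
    simp only [Finset.mem_Icc, not_and_or, not_le] at hl
    rcases hl with hl | hl
    · rw [term, if_neg (by omega)]
    · rw [term.eq_def j k, if_neg (by omega), term_zero_right]

theorem sum_antidiagonal_assoc {M : Type*} [AddCommMonoid M] (e : ℕ) (f : ℕ → ℕ → ℕ → M) :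
    ∑ nr ∈ Finset.HasAntidiagonal.antidiagonal e, ∑ pq ∈ Finset.HasAntidiagonal.antidiagonal nr.2, f nr.1 pq.1 pq.2 =
      ∑ qt ∈ Finset.HasAntidiagonal.antidiagonal e, ∑ np ∈ Finset.HasAntidiagonal.antidiagonal qt.2, f np.1 np.2 qt.1 := by
  rw [Finset.sum_sigma', Finset.sum_sigma']
  refine Finset.sum_bij'
    (fun x _ => ⟨(x.2.2, x.1.1 + x.2.1), (x.1.1, x.2.1)⟩)
    (fun x _ => ⟨(x.2.1, x.2.2 + x.1.1), (x.2.2, x.1.1)⟩) ?_ ?_ ?_ ?_ ?_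
  all_goals
    rintro ⟨⟨u, v⟩, ⟨w, z⟩⟩ hx
    simp only [Finset.mem_sigma, Finset.HasAntidiagonal.mem_antidiagonal] at hx ⊢
  · exact ⟨by omega, trivial⟩
  · exact ⟨by omega, trivial⟩
  · obtain ⟨h1, rfl⟩ := hx; rfl
  · obtain ⟨h1, rfl⟩ := hx; rfl

theorem monomial_assoc (i j : ℤ) (e : ℕ) (a b c : ℂ[T;T⁻¹]) :
    ∑ nr ∈ Finset.HasAntidiagonal.antidiagonal e,
        (Ring.choose i nr.1 * Ring.choose (i + j - nr.1) nr.2) •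
          (a * dx^[nr.1] b * dx^[nr.2] c) =
      ∑ qt ∈ Finset.HasAntidiagonal.antidiagonal e,
        (Ring.choose i qt.2 * Ring.choose j qt.1) • (a * dx^[qt.2] (b * dx^[qt.1] c)) := by
  have hl : ∀ nr ∈ Finset.HasAntidiagonal.antidiagonal e,
      (Ring.choose i nr.1 * Ring.choose (i + j - nr.1) nr.2) •
          (a * dx^[nr.1] b * dx^[nr.2] c) =
        ∑ pq ∈ Finset.HasAntidiagonal.antidiagonal nr.2,
          (Ring.choose i (nr.1 + pq.1) * ((nr.1 + pq.1).choose nr.1 : ℤ) * Ring.choose j pq.2) •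
            (a * dx^[nr.1] b * dx^[pq.1 + pq.2] c) := by
    rintro ⟨n, r⟩ _
    simp only
    rw [show i + j - (n : ℤ) = (i - n) + j by ring, Ring.add_choose_eq r (Commute.all _ _),
      Finset.mul_sum, Finset.sum_smul]
    refine Finset.sum_congr rfl ?_
    rintro ⟨p, q⟩ hpq
    simp only [Finset.HasAntidiagonal.mem_antidiagonal] at hpq
    have h := Ring.choose_smul_choose i (Nat.le_add_right n p)
    rw [Nat.add_sub_cancel_left, nsmul_eq_mul] at h
    rw [← mul_assoc, ← h]
    simp only [hpq]
    congr 2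
    ring
  have hr : ∀ qt ∈ Finset.HasAntidiagonal.antidiagonal e,
      (Ring.choose i qt.2 * Ring.choose j qt.1) • (a * dx^[qt.2] (b * dx^[qt.1] c)) =
        ∑ np ∈ Finset.HasAntidiagonal.antidiagonal qt.2,
          (Ring.choose i (np.1 + np.2) * ((np.1 + np.2).choose np.1 : ℤ) * Ring.choose j qt.1) •
            (a * dx^[np.1] b * dx^[np.2 + qt.1] c) := by
    rintro ⟨q, t⟩ _
    simp only
    rw [dx_iterate_mul, Finset.mul_sum, Finset.smul_sum]
    refine Finset.sum_congr rfl ?_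
    rintro ⟨n, p⟩ hnp
    simp only [Finset.HasAntidiagonal.mem_antidiagonal] at hnp
    simp only [hnp, Function.iterate_add_apply]
    rw [mul_smul_comm, ← natCast_zsmul, smul_smul, mul_assoc a]
    congr 1
    ring
  rw [Finset.sum_congr rfl hl, Finset.sum_congr rfl hr]
  exact sum_antidiagonal_assoc e fun n p q =>
    (Ring.choose i (n + p) * ((n + p).choose n : ℤ) * Ring.choose j q) •
      (a * dx^[n] b * dx^[p + q] c)

protected theorem mul_assoc' (P Q S : PsiDif) : P * Q * S = P * (Q * S) := by
  obtain ⟨N, hN⟩ := P.bounded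
  obtain ⟨M, hM⟩ := Q.bounded
  obtain ⟨K, hK⟩ := S.bounded
  ext1
  funext m
  have e1 : (P * Q * S).coeff m = ∑ i ∈ Finset.Icc (m - M - K) N,
      ∑ j ∈ Finset.Icc (m - N - K) M, ∑ k ∈ Finset.Icc (m - N - M) K,
        ∑ l ∈ Finset.Icc (m - K) (N + M),
          term l k m (term i j l (P.coeff i) (Q.coeff j)) (S.coeff k) := by
    change mulCoeff (P * Q) S m = _
    rw [mulCoeff_eq_box (P * Q) S (N + M) K
      (fun l hl => mulCoeff_eq_zero P Q N M hN hM l hl) hK m (m - K) (m - N - M) le_rfl (by omega)]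
    have : ∀ l ∈ Finset.Icc (m - K) (N + M), (P * Q).coeff l =
        ∑ i ∈ Finset.Icc (m - M - K) N, ∑ j ∈ Finset.Icc (m - N - K) M,
          term i j l (P.coeff i) (Q.coeff j) := by
      intro l hl
      rw [Finset.mem_Icc] at hl
      exact mulCoeff_eq_box P Q N M hN hM l _ _ (by omega) (by omega)
    rw [Finset.sum_congr rfl fun l hl => by rw [this l hl]]
    simp only [term_sum_left]
    rw [Finset.sum_comm, Finset.sum_congr rfl fun k _ => Finset.sum_comm, Finset.sum_comm]
    refine Finset.sum_congr rfl fun i _ => ?_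
    rw [Finset.sum_congr rfl fun k _ => Finset.sum_comm, Finset.sum_comm]
  have e2 : (P * (Q * S)).coeff m = ∑ i ∈ Finset.Icc (m - M - K) N,
      ∑ j ∈ Finset.Icc (m - N - K) M, ∑ k ∈ Finset.Icc (m - N - M) K,
        ∑ l ∈ Finset.Icc (m - N) (M + K),
          term i l m (P.coeff i) (term j k l (Q.coeff j) (S.coeff k)) := by
    change mulCoeff P (Q * S) m = _
    rw [mulCoeff_eq_box P (Q * S) N (M + K) hN
      (fun l hl => mulCoeff_eq_zero Q S M K hM hK l hl) m (m - M - K) (m - N) (by omega) le_rfl]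
    have : ∀ l ∈ Finset.Icc (m - N) (M + K), (Q * S).coeff l =
        ∑ j ∈ Finset.Icc (m - N - K) M, ∑ k ∈ Finset.Icc (m - N - M) K,
          term j k l (Q.coeff j) (S.coeff k) := by
      intro l hl
      rw [Finset.mem_Icc] at hl
      exact mulCoeff_eq_box Q S M K hM hK l _ _ (by omega) (by omega)
    refine Finset.sum_congr rfl fun i _ => ?_
    rw [Finset.sum_congr rfl fun l hl => by rw [this l hl]]
    simp only [term_sum_right]
    rw [Finset.sum_comm]
    refine Finset.sum_congr rfl fun j _ => ?_
    rw [Finset.sum_comm]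
  rw [e1, e2]
  refine Finset.sum_congr rfl fun i hi => Finset.sum_congr rfl fun j hj =>
    Finset.sum_congr rfl fun k hk => ?_
  rw [Finset.mem_Icc] at hi hj hk
  rw [sum_term_left _ _ _ _ _ _ _ _ (Finset.Icc_subset_Icc (by omega) (by omega)),
    sum_term_right _ _ _ _ _ _ _ _ (Finset.Icc_subset_Icc (by omega) (by omega)), monomial_assoc]

protected theorem left_distrib' (P Q S : PsiDif) : P * (Q + S) = P * Q + P * S := by
  obtain ⟨N, hN⟩ := P.bounded
  obtain ⟨M, hM⟩ := Q.bounded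
  obtain ⟨K, hK⟩ := S.bounded
  have hM' : ∀ i, max M K < i → Q.coeff i = 0 := fun i hi => hM i (lt_of_le_of_lt (le_max_left ..) hi)
  have hK' : ∀ i, max M K < i → S.coeff i = 0 := fun i hi => hK i (lt_of_le_of_lt (le_max_right ..) hi)
  have hs : ∀ i, max M K < i → (Q + S).coeff i = 0 := fun i hi => by
    change Q.coeff i + S.coeff i = 0
    rw [hM' i hi, hK' i hi, add_zero]
  ext1
  funext m
  change mulCoeff P (Q + S) m = mulCoeff P Q m + mulCoeff P S m
  rw [mulCoeff_eq_box P _ N _ hN hs m _ _ le_rfl le_rfl,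
    mulCoeff_eq_box P _ N _ hN hM' m _ _ le_rfl le_rfl,
    mulCoeff_eq_box P _ N _ hN hK' m _ _ le_rfl le_rfl]
  simp only [← Finset.sum_add_distrib, ← term_add_right]
  rfl

protected theorem right_distrib' (P Q S : PsiDif) : (P + Q) * S = P * S + Q * S := by
  obtain ⟨N, hN⟩ := S.bounded
  obtain ⟨M, hM⟩ := P.bounded
  obtain ⟨K, hK⟩ := Q.bounded
  have hM' : ∀ i, max M K < i → P.coeff i = 0 := fun i hi => hM i (lt_of_le_of_lt (le_max_left ..) hi)
  have hK' : ∀ i, max M K < i → Q.coeff i = 0 := fun i hi => hK i (lt_of_le_of_lt (le_max_right ..) hi)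
  have hs : ∀ i, max M K < i → (P + Q).coeff i = 0 := fun i hi => by
    change P.coeff i + Q.coeff i = 0
    rw [hM' i hi, hK' i hi, add_zero]
  ext1
  funext m
  change mulCoeff (P + Q) S m = mulCoeff P S m + mulCoeff Q S m
  rw [mulCoeff_eq_box _ S _ N hs hN m _ _ le_rfl le_rfl,
    mulCoeff_eq_box _ S _ N hM' hN m _ _ le_rfl le_rfl,
    mulCoeff_eq_box _ S _ N hK' hN m _ _ le_rfl le_rfl]
  simp only [← Finset.sum_add_distrib, ← term_add_left]
  rfl

protected theorem one_mul' (P : PsiDif) : 1 * P = P := by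
  ext1
  funext m
  change mulCoeff 1 P m = _
  rw [mulCoeff, finsum_eq_single _ (0, 0)]
  · change Ring.choose 0 0 • ((Pi.single 0 1 : ℤ → ℂ[T;T⁻¹]) 0 * _) = _
    simp
  · rintro ⟨i, n⟩ h
    change Ring.choose i n • ((Pi.single 0 1 : ℤ → ℂ[T;T⁻¹]) i * _) = _
    by_cases hi : i = 0
    · subst hi
      have : n ≠ 0 := fun hn => h (by rw [hn])
      rw [Ring.choose_zero_pos ℤ (Nat.pos_of_ne_zero this), zero_smul]
    · simp [Pi.single_eq_of_ne hi]

protected theorem mul_one' (P : PsiDif) : P * 1 = P := by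
  ext1
  funext m
  change mulCoeff P 1 m = _
  rw [mulCoeff, finsum_eq_single _ (m, 0)]
  · change Ring.choose m 0 • (_ * (Pi.single 0 1 : ℤ → ℂ[T;T⁻¹]) _) = _
    simp
  · rintro ⟨i, n⟩ h
    change Ring.choose i n • (_ * dx^[n] ((Pi.single 0 1 : ℤ → ℂ[T;T⁻¹]) (m - i + n))) = _
    by_cases hi : m - i + n = 0
    · rw [hi, Pi.single_eq_same]
      cases n with
      | zero => exact absurd (by simp at hi; rw [Prod.mk.injEq]; exact ⟨by omega, rfl⟩) h
      | succ n =>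
        rw [Function.iterate_succ_apply, Derivation.map_one_eq_zero, iterate_map_zero, mul_zero,
          smul_zero]
    · rw [Pi.single_eq_of_ne hi, iterate_map_zero, mul_zero, smul_zero]

instance : Ring PsiDif :=
  { (inferInstance : AddCommGroup PsiDif) with
    mul_assoc := PsiDif.mul_assoc'
    one_mul := PsiDif.one_mul'
    mul_one := PsiDif.mul_one'
    left_distrib := PsiDif.left_distrib'
    right_distrib := PsiDif.right_distrib'
    zero_mul := fun P => by
      have h := PsiDif.right_distrib' 0 0 P
      rw [add_zero] at h
      exact left_eq_add.1 h
    mul_zero := fun P => by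
      have h := PsiDif.left_distrib' P 0 0
      rw [add_zero] at h
      exact left_eq_add.1 h }

/-- The derivation `ad (ln ∂)`:
`a ∂ ^ i ↦ ∑_{n ≥ 1} (1 / n!) (∂_ξ ^ n ln ξ) a⁽ⁿ⁾ = ∑_{n ≥ 1} ((-1) ^ (n - 1) / n) a⁽ⁿ⁾ ∂ ^ (i - n)`
(in the sum below the summation index is `n - 1`). -/
def adLogD : PsiDif →+ PsiDif where
  toFun P :=
    ⟨fun m => ∑ᶠ n : ℕ, ((-1 : ℂ) ^ n / (n + 1)) • dx^[n + 1] (P.coeff (m + n + 1)), by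
      obtain ⟨N, hN⟩ := P.bounded
      refine ⟨N, fun m hm => finsum_eq_zero_of_forall_eq_zero fun n => ?_⟩
      rw [hN _ (by omega), iterate_map_zero, smul_zero]⟩
  map_zero' := by
    ext1
    funext m
    refine finsum_eq_zero_of_forall_eq_zero fun n => ?_
    change _ • dx^[n + 1] 0 = _
    rw [iterate_map_zero, smul_zero]
  map_add' P Q := by
    have key : ∀ (P : PsiDif) (m : ℤ), (Function.support fun n : ℕ =>
        ((-1 : ℂ) ^ n / (n + 1)) • dx^[n + 1] (P.coeff (m + n + 1))).Finite := by
      intro P m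
      obtain ⟨N, hN⟩ := P.bounded
      refine (Set.finite_Iic (N - m).toNat).subset fun n hn => ?_
      by_contra h
      simp only [Set.mem_Iic, not_le] at h
      exact hn (by simp only; rw [hN _ (by omega), iterate_map_zero, smul_zero])
    ext1
    funext m
    change _ = (∑ᶠ n : ℕ, ((-1 : ℂ) ^ n / (n + 1)) • dx^[n + 1] (P.coeff (m + n + 1))) +
      ∑ᶠ n : ℕ, ((-1 : ℂ) ^ n / (n + 1)) • dx^[n + 1] (Q.coeff (m + n + 1))
    rw [← finsum_add_distrib (key P m) (key Q m)]
    refine finsum_congr fun n => ?_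
    rw [← smul_add, ← iterate_map_add]
    rfl

/-- The derivation `ad (ln x)`:
`a ∂ ^ i ↦ [ln x, a ∂ ^ i] = - ∑_{n ≥ 1} (i choose n) a (ln x)⁽ⁿ⁾ ∂ ^ (i - n)`, where
`(ln x)⁽ⁿ⁾ = (-1) ^ (n - 1) (n - 1)! x ^ (-n)` (in the sum below the summation index is `n - 1`). -/
def adLogX : PsiDif →+ PsiDif where
  toFun P :=
    ⟨fun m => -∑ᶠ n : ℕ, (Ring.choose (m + n + 1) (n + 1) : ℤ) •
        (((-1 : ℂ) ^ n * (n.factorial : ℂ)) •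
          (P.coeff (m + n + 1) * LaurentPolynomial.T (-((n : ℤ) + 1)))), by
      obtain ⟨N, hN⟩ := P.bounded
      refine ⟨N, fun m hm => neg_eq_zero.2 (finsum_eq_zero_of_forall_eq_zero fun n => ?_)⟩
      rw [hN _ (by omega), zero_mul, smul_zero, smul_zero]⟩
  map_zero' := by
    ext1
    funext m
    refine neg_eq_zero.2 (finsum_eq_zero_of_forall_eq_zero fun n => ?_)
    change _ • (_ • ((0 : ℂ[T;T⁻¹]) * _)) = _
    rw [zero_mul, smul_zero, smul_zero]
  map_add' P Q := by
    have key : ∀ (P : PsiDif) (m : ℤ), (Function.support fun n : ℕ =>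
        (Ring.choose (m + n + 1) (n + 1) : ℤ) • (((-1 : ℂ) ^ n * (n.factorial : ℂ)) •
          (P.coeff (m + n + 1) * LaurentPolynomial.T (-((n : ℤ) + 1))))).Finite := by
      intro P m
      obtain ⟨N, hN⟩ := P.bounded
      refine (Set.finite_Iic (N - m).toNat).subset fun n hn => ?_
      by_contra h
      simp only [Set.mem_Iic, not_le] at h
      exact hn (by simp only; rw [hN _ (by omega), zero_mul, smul_zero, smul_zero])
    ext1
    funext m
    change _ = (-∑ᶠ n : ℕ, (Ring.choose (m + n + 1) (n + 1) : ℤ) •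
        (((-1 : ℂ) ^ n * (n.factorial : ℂ)) •
          (P.coeff (m + n + 1) * LaurentPolynomial.T (-((n : ℤ) + 1))))) +
      -∑ᶠ n : ℕ, (Ring.choose (m + n + 1) (n + 1) : ℤ) •
        (((-1 : ℂ) ^ n * (n.factorial : ℂ)) •
          (Q.coeff (m + n + 1) * LaurentPolynomial.T (-((n : ℤ) + 1))))
    rw [← neg_add, ← finsum_add_distrib (key P m) (key Q m)]
    refine congrArg Neg.neg (finsum_congr fun n => ?_)
    rw [← smul_add, ← smul_add, ← add_mul]
    rfl

/-- `Q = ∑_{n ≥ 1} ((n - 1)! / n) x ^ (-n) ∂ ^ (-n)`, with `[ad (ln ∂), ad (ln x)] = ad Q`. -/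
def Q : PsiDif where
  coeff m := if m < 0 then
    (((m.natAbs - 1).factorial : ℂ) / m.natAbs) • LaurentPolynomial.T m else 0
  bounded := ⟨0, fun i hi => if_neg (by omega)⟩

/-- The noncommutative residue: the coefficient at `x ^ (-1) ∂ ^ (-1)`. -/
def res (P : PsiDif) : ℂ := (P.coeff (-1)).coeff (-1)

/-- The differential operator `∂ = d/dx`. -/
def d : PsiDif := monomial 1 1

/-- The differential operator `x² ∂`. -/
def x2d : PsiDif := monomial 1 (LaurentPolynomial.T 2)

/-- The constant operator `c`. -/
def const (c : ℂ) : PsiDif := monomial 0 (LaurentPolynomial.C c)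

theorem const_zero : const 0 = 0 := by
  ext1
  simp only [const, monomial, map_zero, Pi.single_zero]
  rfl

end PsiDif

/-- Infinite matrices over `R` whose rows and columns are finite. They contain the matrices with
finitely many nonzero entries as well as the matrices `Id ⊗ r`. -/
@[ext]
structure InfMat (R : Type*) [Ring R] where
  entry : ℕ → ℕ → R
  row_finite : ∀ i, {j | entry i j ≠ 0}.Finite
  col_finite : ∀ j, {i | entry i j ≠ 0}.Finite

namespace InfMat

variable {R : Type*} [Ring R]

theorem entry_injective : Function.Injective (entry : InfMat R → ℕ → ℕ → R) :=
  fun _ _ h => InfMat.ext h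

/-- Apply a map with `f 0 = 0` to all entries. -/
def map {S : Type*} [Ring S] (f : R → S) (hf : f 0 = 0) (M : InfMat R) : InfMat S where
  entry i j := f (M.entry i j)
  row_finite i := (M.row_finite i).subset fun _ hj h => hj (by rw [h, hf])
  col_finite j := (M.col_finite j).subset fun _ hi h => hi (by rw [h, hf])

/-- The diagonal matrix `Id ⊗ r`. -/
def scalar (r : R) : InfMat R where
  entry i j := if i = j then r else 0
  row_finite i := (Set.finite_singleton i).subset fun j hj => by
    by_contra h
    exact hj (if_neg fun e => h e.symm)
  col_finite j := (Set.finite_singleton j).subset fun i hi => by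
    by_contra h
    exact hi (if_neg h)

/-- The composition of the diagonal sum with `τ`, for matrices with finitely many nonzero
entries `τ (Mᵢᵢ)`. -/
def trace (τ : R → ℂ) (M : InfMat R) : ℂ := ∑ᶠ i, τ (M.entry i i)

instance : Zero (InfMat R) := ⟨⟨0, fun _ => by simp, fun _ => by simp⟩⟩

instance : One (InfMat R) := ⟨scalar 1⟩

instance : Add (InfMat R) :=
  ⟨fun M N => ⟨M.entry + N.entry,
    fun i => ((M.row_finite i).union (N.row_finite i)).subset fun j hj => by
      by_contra h
      simp only [Set.mem_union, Set.mem_ofPred_eq, not_or, not_not] at h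
      exact hj (by simp [h.1, h.2]),
    fun j => ((M.col_finite j).union (N.col_finite j)).subset fun i hi => by
      by_contra h
      simp only [Set.mem_union, Set.mem_ofPred_eq, not_or, not_not] at h
      exact hi (by simp [h.1, h.2])⟩⟩

instance : Neg (InfMat R) := ⟨map (fun r => -r) neg_zero⟩

instance : AddCommGroup (InfMat R) where
  add_assoc M N P := entry_injective (add_assoc M.entry N.entry P.entry)
  zero_add M := entry_injective (zero_add M.entry)
  add_zero M := entry_injective (add_zero M.entry)
  add_comm M N := entry_injective (add_comm M.entry N.entry)
  neg_add_cancel M := entry_injective (neg_add_cancel M.entry)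
  nsmul := nsmulRec
  zsmul := zsmulRec

theorem exists_ne_zero_of_finsum {ι : Type*} {f : ι → R} (h : ∑ᶠ i, f i ≠ 0) : ∃ i, f i ≠ 0 := by
  by_contra! h'
  exact h (finsum_eq_zero_of_forall_eq_zero h')

/-- The matrix product. -/
instance : Mul (InfMat R) :=
  ⟨fun M N => ⟨fun i j => ∑ᶠ l, M.entry i l * N.entry l j,
    fun i => ((M.row_finite i).biUnion fun l _ => N.row_finite l).subset fun j hj => by
      obtain ⟨l, hl⟩ := exists_ne_zero_of_finsum hj
      exact Set.mem_biUnion (left_ne_zero_of_mul hl) (right_ne_zero_of_mul hl),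
    fun j => ((N.col_finite j).biUnion fun l _ => M.col_finite l).subset fun i hi => by
      obtain ⟨l, hl⟩ := exists_ne_zero_of_finsum hi
      exact Set.mem_biUnion (right_ne_zero_of_mul hl) (left_ne_zero_of_mul hl)⟩⟩

theorem mul_entry (M N : InfMat R) (i j : ℕ) :
    (M * N).entry i j = ∑ᶠ l, M.entry i l * N.entry l j := rfl

theorem mul_entry_eq_row (M N : InfMat R) (i j : ℕ) (s : Finset ℕ)
    (hs : ∀ l, M.entry i l ≠ 0 → l ∈ s) :
    (M * N).entry i j = ∑ l ∈ s, M.entry i l * N.entry l j :=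
  finsum_eq_sum_of_support_subset _ fun l hl => hs l (left_ne_zero_of_mul hl)

theorem mul_entry_eq_col (M N : InfMat R) (i j : ℕ) (s : Finset ℕ)
    (hs : ∀ l, N.entry l j ≠ 0 → l ∈ s) :
    (M * N).entry i j = ∑ l ∈ s, M.entry i l * N.entry l j :=
  finsum_eq_sum_of_support_subset _ fun l hl => hs l (right_ne_zero_of_mul hl)

instance : Ring (InfMat R) :=
  { (inferInstance : AddCommGroup (InfMat R)) with
    mul_assoc := fun M N P => by
      ext i j
      have hs : ∀ l, M.entry i l ≠ 0 → l ∈ (M.row_finite i).toFinset := fun l hl => by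
        simpa using hl
      have ht : ∀ l, P.entry l j ≠ 0 → l ∈ (P.col_finite j).toFinset := fun l hl => by
        simpa using hl
      rw [mul_entry_eq_col (M * N) P i j _ ht, mul_entry_eq_row M (N * P) i j _ hs]
      simp only [mul_entry_eq_row M N i _ _ hs, mul_entry_eq_col N P _ j _ ht, Finset.sum_mul,
        Finset.mul_sum, mul_assoc]
      exact Finset.sum_comm
    one_mul := fun M => by
      ext i j
      rw [mul_entry_eq_row 1 M i j {i}]
      · change ∑ l ∈ {i}, (if i = l then (1 : R) else 0) * M.entry l j = _
        simp
      · intro l hl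
        by_contra h
        exact hl (if_neg fun e => h (by simp [e]))
    mul_one := fun M => by
      ext i j
      rw [mul_entry_eq_col M 1 i j {j}]
      · change ∑ l ∈ {j}, M.entry i l * (if l = j then (1 : R) else 0) = _
        simp
      · intro l hl
        by_contra h
        exact hl (if_neg fun e => h (by simp [e]))
    left_distrib := fun M N P => by
      ext i j
      have hs : ∀ l, M.entry i l ≠ 0 → l ∈ (M.row_finite i).toFinset := fun l hl => by
        simpa using hl
      change _ = (M * N).entry i j + (M * P).entry i j
      rw [mul_entry_eq_row _ _ i j _ hs, mul_entry_eq_row _ _ i j _ hs,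
        mul_entry_eq_row _ _ i j _ hs, ← Finset.sum_add_distrib]
      exact Finset.sum_congr rfl fun l _ => mul_add _ _ _
    right_distrib := fun M N P => by
      ext i j
      have hs : ∀ l, P.entry l j ≠ 0 → l ∈ (P.col_finite j).toFinset := fun l hl => by
        simpa using hl
      change _ = (M * P).entry i j + (N * P).entry i j
      rw [mul_entry_eq_col _ _ i j _ hs, mul_entry_eq_col _ _ i j _ hs,
        mul_entry_eq_col _ _ i j _ hs, ← Finset.sum_add_distrib]
      exact Finset.sum_congr rfl fun l _ => add_mul _ _ _
    zero_mul := fun M => by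
      ext i j
      exact finsum_eq_zero_of_forall_eq_zero fun l => zero_mul _
    mul_zero := fun M => by
      ext i j
      exact finsum_eq_zero_of_forall_eq_zero fun l => mul_zero _ }

instance : SMul ℂ (InfMat ℂ) := ⟨fun c => map (fun r => c * r) (mul_zero c)⟩

instance : Module ℂ (InfMat ℂ) where
  one_smul M := entry_injective (one_smul ℂ M.entry)
  mul_smul a b M := entry_injective (mul_smul a b M.entry)
  smul_zero a := entry_injective (smul_zero (A := ℕ → ℕ → ℂ) a)
  smul_add a M N := entry_injective (smul_add a M.entry N.entry)
  add_smul a b M := entry_injective (add_smul a b M.entry)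
  zero_smul M := entry_injective (zero_smul ℂ M.entry)

instance : Algebra ℂ (InfMat ℂ) :=
  Algebra.ofModule
    (fun a M N => by
      ext i j
      have hs : ∀ l, M.entry i l ≠ 0 → l ∈ (M.row_finite i).toFinset := fun l hl => by
        simpa using hl
      change _ = a * (M * N).entry i j
      rw [mul_entry_eq_row (a • M) N i j _ fun l hl => hs l (right_ne_zero_of_mul hl),
        mul_entry_eq_row M N i j _ hs, Finset.mul_sum]
      exact Finset.sum_congr rfl fun l _ => mul_assoc _ _ _)
    (fun a M N => by
      ext i j
      have hs : ∀ l, M.entry i l ≠ 0 → l ∈ (M.row_finite i).toFinset := fun l hl => by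
        simpa using hl
      change _ = a * (M * N).entry i j
      rw [mul_entry_eq_row M (a • N) i j _ hs, mul_entry_eq_row M N i j _ hs, Finset.mul_sum]
      exact Finset.sum_congr rfl fun l _ => mul_left_comm _ _ _)

instance : LieRing (InfMat ℂ) := LieRing.ofAssociativeRing

/-- All but finitely many entries vanish. -/
def IsFin (M : InfMat R) : Prop := {p : ℕ × ℕ | M.entry p.1 p.2 ≠ 0}.Finite

theorem IsFin.add {M N : InfMat R} (hM : M.IsFin) (hN : N.IsFin) : (M + N).IsFin :=
  (hM.union hN).subset fun p hp => by
    by_contra h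
    simp only [Set.mem_union, Set.mem_ofPred_eq, not_or, not_not] at h
    exact hp (by change M.entry p.1 p.2 + N.entry p.1 p.2 = 0; rw [h.1, h.2, add_zero])

theorem IsFin.map {S : Type*} [Ring S] {M : InfMat R} (hM : M.IsFin) (f : R → S) (hf : f 0 = 0) :
    (M.map f hf).IsFin :=
  hM.subset fun p hp h => hp (by change f (M.entry p.1 p.2) = 0; rw [h, hf])

theorem IsFin.mul {M N : InfMat R} (hM : M.IsFin) (hN : N.IsFin) : (M * N).IsFin :=
  ((hM.image Prod.fst).prod (hN.image Prod.snd)).subset fun p hp => by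
    obtain ⟨l, hl⟩ := exists_ne_zero_of_finsum hp
    exact ⟨⟨(p.1, l), left_ne_zero_of_mul hl, rfl⟩, ⟨(l, p.2), right_ne_zero_of_mul hl, rfl⟩⟩

end InfMat

/-- The Lie algebra of infinite complex matrices with finitely many nonzero entries, with the
bracket `[A, B] = A B - B A`. -/
def glFin : LieSubalgebra ℂ (InfMat ℂ) where
  carrier := {M | M.IsFin}
  zero_mem' := by
    change Set.Finite {p : ℕ × ℕ | (0 : ℂ) ≠ 0}
    simp
  add_mem' hM hN := hM.add hN
  smul_mem' c _ hM := hM.map _ (mul_zero c)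
  lie_mem' {M N} hM hN := by
    change (M * N - N * M).IsFin
    rw [sub_eq_add_neg]
    exact (hM.mul hN).add ((hN.mul hM).map _ neg_zero)

/-- The matrix unit `E₁₁` (the first row and column have index `0` here). -/
def glFin.E11 : glFin :=
  ⟨⟨fun i j => if i = 0 ∧ j = 0 then 1 else 0,
    fun _ => (Set.finite_singleton 0).subset fun j hj => by
      by_contra h
      exact hj (if_neg fun e => h e.2),
    fun _ => (Set.finite_singleton 0).subset fun i hi => by
      by_contra h
      exact hi (if_neg fun e => h e.1)⟩,
    (Set.finite_singleton (0, 0)).subset fun p hp => by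
      by_contra h
      exact hp (if_neg fun e => h (Prod.ext e.1 e.2))⟩

/-- The alternation `∑_σ sgn σ · f (A_{σ 1}, …, A_{σ n})`, without normalizing factor. -/
def alternate {V W : Type*} [AddCommGroup W] {n : ℕ} (f : (Fin n → V) → W) (A : Fin n → V) : W :=
  ∑ σ : Equiv.Perm (Fin n), (Equiv.Perm.sign σ : ℤ) • f (A ∘ σ)

section Lifting

variable {𝔄 : Type*} [Ring 𝔄]

/-- The product `D A₁ · A₂ · … · A_{2s-1} · D' A_{2s} · A_{2s+1} · … · A_n`. -/
def liftingWord (D D' : 𝔄 → 𝔄) (s : ℕ) {n : ℕ} (A : Fin n → 𝔄) : 𝔄 :=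
  (List.ofFn fun j : Fin n =>
    if j.val = 0 then D (A j) else if j.val + 1 = 2 * s then D' (A j) else A j).prod

/-- The coefficient of the word with `D₂` in position `2s` in the lifting formula for
`Ψ_{2k+1}`: it is `1` if `2s ≤ k + 1`, it is `1/2` if `2s = k + 2` (which happens for even `k`
only), and there are no further terms. -/
def liftingWeight (k s : ℕ) : ℂ :=
  if 2 * s ≤ k + 1 then 1 else if 2 * s = k + 2 then 1 / 2 else 0

/-- The lifting formula for `Ψ_{2k+1}` (`k ≥ 1`) on an algebra with a trace `Tr`, and derivations
`D₁`, `D₂` with `[D₁, D₂] = ad Q`: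
`Alt_A Tr (Q A₁ ⋯ A_{2k+1}) +
  Alt_{A,D} Tr (D₁A₁ D₂A₂ A₃ ⋯ A_{2k+1} + D₁A₁ A₂ A₃ D₂A₄ A₅ ⋯ A_{2k+1} + ⋯)`. -/
def lifting (Tr : 𝔄 → ℂ) (D₁ D₂ : 𝔄 → 𝔄) (Q : 𝔄) (k : ℕ) (A : Fin (2 * k + 1) → 𝔄) : ℂ :=
  alternate (fun B => Tr (Q * (List.ofFn B).prod)) A +
    ∑ s ∈ Finset.Icc 1 k, liftingWeight k s *
      alternate (fun B => Tr (liftingWord D₁ D₂ s B) - Tr (liftingWord D₂ D₁ s B)) A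

end Lifting

/-- The lifting cochain `Ψ_{2k+1}` for matrices over pseudo-differential operators on the circle:
`Tr` is the composition of the matrix trace with the residue, `D₁ = ad (ln ∂)`, `D₂ = ad (ln x)`
act entrywise, and `Q` stands for `Id ⊗ Q`. The formula makes sense as soon as one of the arguments
has finitely many nonzero entries. -/
def Psi (k : ℕ) : (Fin (2 * k + 1) → InfMat PsiDif) → ℂ :=
  lifting (InfMat.trace PsiDif.res)
    (InfMat.map PsiDif.adLogD (map_zero _)) (InfMat.map PsiDif.adLogX (map_zero _))
    (InfMat.scalar PsiDif.Q) k

/-- The inclusion `A ↦ A ⊗ 1` of matrices of numbers into matrices of operators. -/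
def tensorOne (A : glFin) : InfMat PsiDif := (A : InfMat ℂ).map PsiDif.const PsiDif.const_zero

/-- `Ψ_{2k+1} (Id ⊗ ∂, Id ⊗ x²∂, A₁ ⊗ 1, …, A_{2k-1} ⊗ 1)`. -/
def PsiContracted (k : ℕ) (A : Fin (2 * k - 1) → glFin) : ℂ :=
  Psi k fun j =>
    if j.val = 0 then InfMat.scalar PsiDif.d
    else if h : 2 ≤ j.val then tensorOne (A ⟨j.val - 2, by omega⟩)
    else InfMat.scalar PsiDif.x2d

section Chains

variable {L : Type*} [LieRing L] [LieAlgebra ℂ L]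

/-- The Chevalley–Eilenberg boundary of `x₁ ∧ … ∧ x_p`:
`∑_{a < b} (-1) ^ (a + b) [x_a, x_b] ∧ x₁ ∧ … x̂_a … x̂_b … ∧ x_p`. -/
def boundary {p : ℕ} (x : Fin p → L) : ExteriorAlgebra ℂ L :=
  ∑ a : Fin p, ∑ b ∈ Finset.Ioi a, (-1 : ℂ) ^ (a.val + b.val) •
    (ExteriorAlgebra.ι ℂ ⁅x a, x b⁆ *
      (((List.finRange p).filter fun l => l ≠ a ∧ l ≠ b).map
        fun l => ExteriorAlgebra.ι ℂ (x l)).prod)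

/-- The chain `∑ᵢ x₁⁽ⁱ⁾ ∧ … ∧ x_p⁽ⁱ⁾` with trivial coefficients is a cycle. -/
def IsCycle {m p : ℕ} (x : Fin m → Fin p → L) : Prop := ∑ i, boundary (x i) = 0

end Chains

end

open scoped LaurentPolynomial

noncomputable section

open PsiDif

/-! ### Operators: the values of the two derivations and three residues -/

namespace PsiDif

open LaurentPolynomial (T C)

/-! Value of the cochain. A product of matrices `P ⊗ M` factors as (product of the operators) ⊗
(product of the matrices), and its trace is a residue times a matrix trace. Expanding the
alternation by the slots `p`, `q` taken by `Id ⊗ ∂` and `Id ⊗ x²∂` (`alternate_cons` twice, packaged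
in `alternate_tensor`) therefore makes every term of the cochain a number times t = Alt tr(A₁ ⋯
A_{2k-1}).

For the term with `Q` the number is a signed count of slots times res(Q[∂, x²∂]) = -1, and the count
is k (`sum_sign_insertNth_insertNth`). In the other words both derivations kill 1, so they must fall
on ∂ and x²∂; since also D₁∂ = 0, only D₁(x²∂) and D₂∂ occur, and the product of these two has
residue 1 in either order. Each s thus gives -2 (`sum_sign_liftingWord`), and the weights add up to
(k + 1)/2 (`sum_liftingWeight`). The total is -k - (k + 1) = -(2k + 1).

A cycle with t ≠ 0. Let X be the N × N matrix whose entries are the generators `Eᵢⱼ` of the exterior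
algebra, and n even. The chain is the sum of the wedges of matrix units along all closed paths with
n + 1 edges, which is tr X^{n+1}. Summing boundaries along paths gives matrices with B_{n+1} = -N Xⁿ
+ tr(Xⁿ) Id - X Bₙ (`pathSum_boundary_succ`). Unrolling and taking traces leaves ∑ (-1)^m (-N tr Xⁿ
+ tr X^m tr X^{n-m}), which vanishes by graded commutativity (`trace_pathSum_boundary`).

On this chain t equals ∑ c · Alt c, where c is the indicator of closed paths; up to a factorial this
is a sum of squares (`sum_mul_alternate_ne_zero`). One square is nonzero: for N = n + 1, the only
reorderings of the full cycle that remain closed paths are rotations, and a rotation of an odd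
number of edges is even. -/

theorem coeff_sub (P S : PsiDif) (m : ℤ) : (P - S).coeff m = P.coeff m - S.coeff m := rfl

theorem coeff_smul (c : ℂ) (P : PsiDif) (m : ℤ) : (c • P).coeff m = c • P.coeff m := rfl

theorem coeff_mul (P S : PsiDif) (m : ℤ) : (P * S).coeff m = mulCoeff P S m := rfl

theorem coeff_monomial (n m : ℤ) (a : ℂ[T;T⁻¹]) :
    (monomial n a).coeff m = if m = n then a else 0 := Pi.single_apply n a m

theorem coeff_monomial_mul_monomial (i j m : ℤ) (a b : ℂ[T;T⁻¹]) :
    (monomial i a * monomial j b).coeff m = term i j m a b := by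
  rw [coeff_mul, mulCoeff_eq_sum _ _ _ {i} {j}]
  · simp [coeff_monomial]
  · intro i' j' _ hi hj
    rw [coeff_monomial] at hi hj
    simp only [Finset.mem_singleton]
    exact ⟨by_contra fun h => hi (if_neg h), by_contra fun h => hj (if_neg h)⟩

theorem dx_T (n : ℤ) : dx (T n : ℂ[T;T⁻¹]) = (n : ℂ) • T (n - 1) := by
  change dxLin (AddMonoidAlgebra.single n 1) = _
  rw [dxLin_single, LaurentPolynomial.T, AddMonoidAlgebra.smul_single, one_mul, smul_eq_mul,
    mul_one]

theorem dx_iterate_C (n : ℕ) (c : ℂ) : dx^[n + 1] (C c : ℂ[T;T⁻¹]) = 0 := by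
  rw [Function.iterate_succ_apply]
  have : dx (C c : ℂ[T;T⁻¹]) = 0 := dx.map_algebraMap c
  rw [this, iterate_map_zero]

theorem const_mul (c : ℂ) (P : PsiDif) : const c * P = c • P := by
  ext1
  funext m
  rw [coeff_mul, coeff_smul, mulCoeff, finsum_eq_single _ (0, 0)]
  · simp [const, coeff_monomial, LaurentPolynomial.smul_eq_C_mul]
  · rintro ⟨i, n⟩ h
    by_cases hi : i = 0
    · subst hi
      have : n ≠ 0 := fun hn => h (by rw [hn])
      rw [Ring.choose_zero_pos ℤ (Nat.pos_of_ne_zero this), zero_smul]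
    · simp [const, coeff_monomial, hi]

/-- All derivatives of a constant vanish, so the composition has no lower-order corrections.
Constants are thus central, which lets numerical matrices factor out of products. -/
theorem mul_const (c : ℂ) (P : PsiDif) : P * const c = c • P := by
  ext1
  funext m
  rw [coeff_mul, coeff_smul, mulCoeff, finsum_eq_single _ (m, 0)]
  · simp [const, coeff_monomial, LaurentPolynomial.smul_eq_C_mul, mul_comm]
  · rintro ⟨i, n⟩ h
    rw [const, coeff_monomial]
    split_ifs with hi
    · cases n with
      | zero => exact absurd (by rw [Prod.mk.injEq]; exact ⟨by simp at hi; omega, rfl⟩) h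
      | succ n => rw [dx_iterate_C, mul_zero, smul_zero]
    · rw [iterate_map_zero, mul_zero, smul_zero]

theorem const_one : const 1 = 1 := by
  change monomial 0 (C 1) = monomial 0 1
  rw [map_one]

theorem res_sub (P S : PsiDif) : res (P - S) = res P - res S := by
  simp [res, coeff_sub]

theorem res_smul (c : ℂ) (P : PsiDif) : res (c • P) = c * res P := by
  simp [res, coeff_smul]

theorem res_zero : res 0 = 0 := rfl

theorem adLogD_smul (c : ℂ) (P : PsiDif) : adLogD (c • P) = c • adLogD P := by
  ext1
  funext m
  change ∑ᶠ n : ℕ, ((-1 : ℂ) ^ n / (n + 1)) • dx^[n + 1] (c • P.coeff (m + n + 1)) =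
    c • ∑ᶠ n : ℕ, ((-1 : ℂ) ^ n / (n + 1)) • dx^[n + 1] (P.coeff (m + n + 1))
  rw [smul_finsum]
  refine finsum_congr fun n => ?_
  have : dx^[n + 1] (c • P.coeff (m + n + 1)) = c • dx^[n + 1] (P.coeff (m + n + 1)) :=
    Function.Commute.iterate_left (f := dx) (g := fun a => c • a) (fun a => dx.map_smul c a)
      (n + 1) _
  rw [this, smul_comm]

theorem adLogX_smul (c : ℂ) (P : PsiDif) : adLogX (c • P) = c • adLogX P := by
  ext1
  funext m
  change (-∑ᶠ n : ℕ, (Ring.choose (m + n + 1) (n + 1) : ℤ) • (((-1 : ℂ) ^ n * (n.factorial : ℂ)) •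
      ((c • P.coeff (m + n + 1)) * T (-((n : ℤ) + 1))))) =
    c • (-∑ᶠ n : ℕ, (Ring.choose (m + n + 1) (n + 1) : ℤ) •
      (((-1 : ℂ) ^ n * (n.factorial : ℂ)) • (P.coeff (m + n + 1) * T (-((n : ℤ) + 1)))))
  rw [smul_neg, smul_finsum]
  refine congrArg Neg.neg (finsum_congr fun n => ?_)
  rw [smul_mul_assoc, smul_comm c (Ring.choose _ _), smul_comm c (_ * _ : ℂ)]

theorem adLogD_monomial_C (i : ℤ) (c : ℂ) : adLogD (monomial i (C c)) = 0 := by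
  ext1
  funext m
  refine finsum_eq_zero_of_forall_eq_zero fun n => ?_
  rw [coeff_monomial]
  split_ifs
  · rw [dx_iterate_C, smul_zero]
  · rw [iterate_map_zero, smul_zero]

theorem adLogD_d : adLogD d = 0 := by
  rw [d, ← map_one (C : ℂ →+* ℂ[T;T⁻¹]), adLogD_monomial_C]

theorem adLogD_one : adLogD 1 = 0 := by
  rw [← const_one, const, adLogD_monomial_C]

theorem coeff_adLogX_monomial (i m : ℤ) (a : ℂ[T;T⁻¹]) :
    (adLogX (monomial i a)).coeff m = if m < i then
      -((Ring.choose i (i - m).toNat : ℤ) • (((-1 : ℂ) ^ ((i - m).toNat - 1) *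
        (((i - m).toNat - 1).factorial : ℂ)) • (a * T (m - i)))) else 0 := by
  change -∑ᶠ n : ℕ, (Ring.choose (m + n + 1) (n + 1) : ℤ) • (((-1 : ℂ) ^ n * (n.factorial : ℂ)) •
      ((monomial i a).coeff (m + n + 1) * T (-((n : ℤ) + 1)))) = _
  split_ifs with h
  · rw [finsum_eq_single _ ((i - m).toNat - 1)]
    · have h1 : m + (((i - m).toNat - 1 : ℕ) : ℤ) + 1 = i := by omega
      have h2 : (i - m).toNat - 1 + 1 = (i - m).toNat := by omega
      have h3 : -((((i - m).toNat - 1 : ℕ) : ℤ) + 1) = m - i := by omega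
      rw [h1, h2, h3, coeff_monomial, if_pos rfl]
    · intro n hn
      rw [coeff_monomial, if_neg (by omega), zero_mul, smul_zero, smul_zero]
  · refine neg_eq_zero.2 (finsum_eq_zero_of_forall_eq_zero fun n => ?_)
    rw [coeff_monomial, if_neg (by omega), zero_mul, smul_zero, smul_zero]

theorem adLogX_one : adLogX 1 = 0 := by
  ext1
  funext m
  change (adLogX (monomial 0 1)).coeff m = 0
  rw [coeff_adLogX_monomial]
  split_ifs with h
  · rw [Ring.choose_zero_pos ℤ (by omega), zero_smul, neg_zero]
  · rfl

theorem choose_one_eq_zero {n : ℕ} (hn : 1 < n) : (Ring.choose (1 : ℤ) n : ℤ) = 0 := by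
  have := Ring.choose_natCast (R := ℤ) 1 n
  rw [Nat.cast_one, Nat.choose_eq_zero_of_lt hn, Nat.cast_zero] at this
  exact this

theorem adLogX_d : adLogX d = monomial 0 (-T (-1)) := by
  ext1
  funext m
  rw [d, coeff_adLogX_monomial, coeff_monomial]
  rcases lt_trichotomy m 0 with h | rfl | h
  · rw [if_pos (by omega), if_neg (by omega), choose_one_eq_zero (by omega), zero_smul, neg_zero]
  · simp
  · rw [if_neg (by omega), if_neg (by omega)]

theorem dx_iterate_T_two (n : ℕ) : dx^[n + 3] (T 2 : ℂ[T;T⁻¹]) = 0 := by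
  rw [Function.iterate_add_apply]
  have : dx^[3] (T 2 : ℂ[T;T⁻¹]) = 0 := by
    simp [dx_T]
  rw [this, iterate_map_zero]

/-- The third derivative of x² is zero, so the series stops after n = 2: the terms are 2x and -(1/2)
· 2 ∂⁻¹. -/
theorem adLogD_x2d :
    adLogD x2d = monomial 0 ((2 : ℂ) • T 1) - monomial (-1) 1 := by
  ext1
  funext m
  rw [coeff_sub, coeff_monomial, coeff_monomial]
  change ∑ᶠ n : ℕ, ((-1 : ℂ) ^ n / (n + 1)) • dx^[n + 1] ((monomial 1 (T 2)).coeff (m + n + 1)) = _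
  by_cases h : m ≤ 0
  · rw [finsum_eq_single _ (-m).toNat]
    · rw [coeff_monomial, if_pos (by omega)]
      obtain rfl | rfl | ⟨n, rfl⟩ : m = 0 ∨ m = -1 ∨ ∃ n : ℕ, m = -(n + 2 : ℤ) := by
        by_cases h0 : m = 0
        · exact .inl h0
        · by_cases h1 : m = -1
          · exact .inr (.inl h1)
          · exact .inr (.inr ⟨(-m - 2).toNat, by omega⟩)
      · simp [dx_T]
      · simp [dx_T, smul_smul]
        norm_num
      · rw [show (- -((n : ℤ) + 2)).toNat = n + 2 by omega, dx_iterate_T_two, if_neg (by omega),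
          if_neg (by omega), smul_zero, sub_zero]
    · intro n hn
      rw [coeff_monomial, if_neg (by omega), iterate_map_zero, smul_zero]
  · rw [if_neg (by omega), if_neg (by omega), sub_zero]
    refine finsum_eq_zero_of_forall_eq_zero fun n => ?_
    rw [coeff_monomial, if_neg (by omega), iterate_map_zero, smul_zero]

theorem res_monomial_mul_monomial (i j : ℤ) (a b : ℂ[T;T⁻¹]) :
    res (monomial i a * monomial j b) = (term i j (-1) a b).coeff (-1) := by
  rw [res, coeff_monomial_mul_monomial]

/-- The product is (2x - ∂⁻¹)(-x⁻¹). The part from 2x has order zero, and ∂⁻¹ ∘ x⁻¹ starts with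
x⁻¹∂⁻¹. -/
theorem res_adLogD_x2d_mul_adLogX_d : res (adLogD x2d * adLogX d) = 1 := by
  rw [adLogD_x2d, adLogX_d, sub_mul, res_sub, res_monomial_mul_monomial, res_monomial_mul_monomial]
  simp [term]

theorem res_adLogX_d_mul_adLogD_x2d : res (adLogX d * adLogD x2d) = 1 := by
  rw [adLogD_x2d, adLogX_d, mul_sub, res_sub, res_monomial_mul_monomial, res_monomial_mul_monomial]
  simp [term]

theorem d_mul_x2d_sub : d * x2d - x2d * d = monomial 1 ((2 : ℂ) • T 1) := by
  ext1
  funext m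
  rw [coeff_sub, d, x2d, coeff_monomial_mul_monomial, coeff_monomial_mul_monomial, coeff_monomial,
    term, term]
  by_cases h : m ≤ 2
  · rw [if_pos (by omega), if_pos (by omega)]
    obtain rfl | rfl | h' : m = 2 ∨ m = 1 ∨ m ≤ 0 := by omega
    · simp
    · simp [dx_T]
    · rw [choose_one_eq_zero (by omega), if_neg (by omega), zero_smul, zero_smul, sub_zero]
  · rw [if_neg (by omega), if_neg (by omega), if_neg (by omega), sub_zero]

/-- Only x⁻¹∂⁻¹ and (1/2)x⁻²∂⁻² in `Q` reach ∂⁻¹ after multiplication by [∂, x²∂] = 2x∂. The first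
contributes -2, through the correction in ∂⁻¹ ∘ x = x∂⁻¹ - ∂⁻² + ⋯, and the second contributes 1. -/
theorem res_Q_mul_commutator : res (Q * (d * x2d)) - res (Q * (x2d * d)) = -1 := by
  rw [← res_sub, ← mul_sub, d_mul_x2d_sub, res, coeff_mul, mulCoeff_eq_sum _ _ _ {-1, -2} {1}]
  · have h1 : (Ring.choose (-1 : ℤ) 1 : ℤ) = -1 := Ring.choose_one_right _
    have hQ1 : Q.coeff (-1) = T (-1) := by simp [Q]
    have hQ2 : Q.coeff (-2) = (1 / 2 : ℂ) • T (-2) := by simp [Q]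
    rw [Finset.sum_pair (by decide), Finset.sum_singleton, Finset.sum_singleton, hQ1, hQ2,
      coeff_monomial, if_pos rfl, term, term, if_pos (by decide), if_pos (by decide),
      show ((-1 : ℤ) + 1 - -1).toNat = 1 from rfl, show ((-2 : ℤ) + 1 - -1).toNat = 0 from rfl,
      Ring.choose_zero_right, h1, Function.iterate_one, Function.iterate_zero, id,
      Derivation.map_smul, dx_T, smul_mul_smul_comm, mul_smul_comm, mul_smul_comm,
      ← LaurentPolynomial.T_add, ← LaurentPolynomial.T_add]
    simp
    norm_num
  · intro i j hij hi hj
    rw [coeff_monomial] at hj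
    have hj' : j = 1 := by_contra fun h => hj (if_neg h)
    have hi' : i < 0 := by_contra fun h => hi (if_neg h)
    simp only [Finset.mem_insert, Finset.mem_singleton]
    omega

end PsiDif

/-! ### Expansion of an alternation by the slot of its first argument -/

theorem alternate_cons {V W : Type*} [AddCommGroup W] {n : ℕ} (f : (Fin (n + 1) → V) → W) (a : V)
    (v : Fin n → V) :
    alternate f (Fin.cons a v : Fin (n + 1) → V) =
      ∑ p : Fin (n + 1), (-1 : ℤ) ^ p.val • alternate (fun w => f (p.insertNth a w)) v := by
  -- A permutation is encoded by the slot `p` that receives the first argument and a permutation of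
  -- the remaining ones. The cycle moving `p` to the front supplies the sign (-1)^p.
  have hbij : Function.Bijective fun x : Fin (n + 1) × Equiv.Perm (Fin n) =>
      Equiv.Perm.decomposeFin.symm (0, x.2) * x.1.cycleRange := by
    rw [Fintype.bijective_iff_injective_and_card]
    refine ⟨?_, ?_⟩
    · rintro ⟨p, τ⟩ ⟨q, ρ⟩ h
      have hp : p = q := by
        have h1 := congrArg (fun σ : Equiv.Perm (Fin (n + 1)) => σ p) h
        simp only [Equiv.Perm.mul_apply, Fin.cycleRange_self,
          Equiv.Perm.decomposeFin_symm_apply_zero] at h1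
        have h2 : Equiv.Perm.decomposeFin.symm (0, ρ) 0 = 0 :=
          Equiv.Perm.decomposeFin_symm_apply_zero _ _
        have h3 := (Equiv.injective _ (h2.trans h1)).symm
        rw [← Fin.cycleRange_self q] at h3
        exact Equiv.injective _ h3
      subst hp
      have := Equiv.injective _ (mul_right_cancel h)
      simpa using this
    · rw [Fintype.card_prod, Fintype.card_perm, Fintype.card_perm, Fintype.card_fin,
        Fintype.card_fin, Nat.factorial_succ]
  rw [alternate, ← hbij.sum_comp, Fintype.sum_prod_type]
  refine Finset.sum_congr rfl fun p _ => ?_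
  rw [alternate, Finset.smul_sum]
  refine Finset.sum_congr rfl fun τ _ => ?_
  have hcomp : (Fin.cons a v : Fin (n + 1) → V) ∘
      ⇑(Equiv.Perm.decomposeFin.symm (0, τ) * p.cycleRange) = p.insertNth a (v ∘ τ) := by
    rw [← Fin.cons_comp_cycleRange, Equiv.Perm.coe_mul, ← Function.comp_assoc]
    congr 1
    funext j
    refine Fin.cases ?_ (fun j => ?_) j <;> simp
  simp only
  rw [hcomp, smul_smul, Equiv.Perm.sign_mul, Fin.sign_cycleRange,
    Equiv.Perm.decomposeFin.symm_sign, if_pos rfl, one_mul, mul_comm]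
  push_cast
  rfl

theorem alternate_mul_left {V : Type*} {n : ℕ} (c : ℂ) (f : (Fin n → V) → ℂ) (v : Fin n → V) :
    alternate (fun w => c * f w) v = c * alternate f v := by
  simp only [alternate, Finset.mul_sum, mul_smul_comm]

/-! ### Products of lists that are 1 except in one or two places -/

section ListProd

variable {M : Type*} [Monoid M]

theorem prod_ofFn_insertNth_one {n : ℕ} (p : Fin (n + 1)) (w : Fin n → M) :
    (List.ofFn (p.insertNth (1 : M) w : Fin (n + 1) → M)).prod = (List.ofFn w).prod := by
  induction n with
  | zero =>
    obtain rfl : p = 0 := Fin.fin_one_eq_zero p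
    simp
  | succ n ih =>
    induction p using Fin.cases with
    | zero => simp [Fin.insertNth_zero', List.ofFn_succ]
    | succ p =>
      rw [← Fin.cons_self_tail w, Fin.insertNth_succ_cons, List.ofFn_cons, List.ofFn_cons,
        List.prod_cons, List.prod_cons, ih]

theorem cons_one_one {n : ℕ} : (Fin.cons 1 1 : Fin (n + 1) → M) = 1 := by
  funext j
  refine Fin.cases ?_ (fun j => ?_) j <;> simp

theorem prod_ofFn_one (n : ℕ) : (List.ofFn (1 : Fin n → M)).prod = 1 :=
  List.prod_eq_one fun x hx => by
    obtain ⟨j, rfl⟩ := List.mem_ofFn.1 hx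
    rfl

theorem prod_ofFn_insertNth_one_right {n : ℕ} (p : Fin (n + 1)) (a : M) :
    (List.ofFn (p.insertNth a 1 : Fin (n + 1) → M)).prod = a := by
  induction n with
  | zero =>
    obtain rfl : p = 0 := Fin.fin_one_eq_zero p
    simp
  | succ n ih =>
    induction p using Fin.cases with
    | zero => rw [Fin.insertNth_zero', List.ofFn_cons, List.prod_cons, prod_ofFn_one, mul_one]
    | succ p =>
      rw [← cons_one_one, Fin.insertNth_succ_cons, List.ofFn_cons, List.prod_cons, ih, one_mul]

theorem prod_ofFn_insertNth_insertNth {n : ℕ} (p : Fin (n + 2)) (q : Fin (n + 1)) (a b : M) :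
    (List.ofFn (p.insertNth a (q.insertNth b 1 : Fin (n + 1) → M) : Fin (n + 2) → M)).prod =
      if p.val ≤ q.val then a * b else b * a := by
  induction p using Fin.cases with
  | zero =>
    rw [Fin.insertNth_zero', List.ofFn_cons, List.prod_cons, prod_ofFn_insertNth_one_right,
      if_pos (by simp)]
  | succ p =>
    induction n with
    | zero =>
      obtain rfl : q = 0 := Fin.fin_one_eq_zero q
      rw [Fin.insertNth_zero', Fin.insertNth_succ_cons, List.ofFn_cons, List.prod_cons,
        prod_ofFn_insertNth_one_right, if_neg (by simp)]
    | succ n ih =>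
      induction q using Fin.cases with
      | zero =>
        rw [Fin.insertNth_zero', Fin.insertNth_succ_cons, List.ofFn_cons, List.prod_cons,
          prod_ofFn_insertNth_one_right, if_neg (by simp)]
      | succ q =>
        rw [← cons_one_one, Fin.insertNth_succ_cons, Fin.insertNth_succ_cons, List.ofFn_cons,
          List.prod_cons, one_mul]
        induction p using Fin.cases with
        | zero =>
          rw [Fin.insertNth_zero', List.ofFn_cons, List.prod_cons, prod_ofFn_insertNth_one_right,
            if_pos (by simp)]
        | succ p =>
          rw [ih]
          simp

end ListProd

/-! ### Words in which only two letters differ from 1 -/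

section LiftingWord

variable {𝔄 : Type*} [Ring 𝔄]

theorem prod_ofFn_eq_zero {n : ℕ} {f : Fin n → 𝔄} (j : Fin n) (h : f j = 0) :
    (List.ofFn f).prod = 0 :=
  List.prod_eq_zero (List.mem_ofFn.2 ⟨j, h⟩)

/-- This is the part of a word after its first letter. The shift by one turns the condition `j + 1 =
2 * s` of `liftingWord` into `j + 2 = 2 * s`. -/
theorem prod_ofFn_modify_insertNth {D : 𝔄 → 𝔄} (hD : D 1 = 0) {n s : ℕ} (hs : 1 ≤ s)
    (hsn : 2 * s ≤ n + 2) (q : Fin (n + 1)) (b : 𝔄) :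
    (List.ofFn fun j : Fin (n + 1) => if j.val + 2 = 2 * s then
        D ((q.insertNth b 1 : Fin (n + 1) → 𝔄) j) else (q.insertNth b 1 : Fin (n + 1) → 𝔄) j).prod =
      if q.val + 2 = 2 * s then D b else 0 := by
  split_ifs with h
  · rw [← prod_ofFn_insertNth_one_right q (D b)]
    congr 2
    funext j
    induction j using q.succAboveCases with
    | x => simp [h]
    | p j =>
      have : (q.succAbove j).val ≠ q.val := fun e => q.succAbove_ne j (Fin.ext e)
      rw [if_neg (by omega)]
      simp
  · have hlt : 2 * s - 2 < n + 1 := by omega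
    refine prod_ofFn_eq_zero ⟨2 * s - 2, hlt⟩ ?_
    rw [if_pos (by simp only; omega)]
    obtain ⟨j, hj⟩ := Fin.exists_succAbove_eq (x := ⟨2 * s - 2, hlt⟩) (y := q)
      (fun e => h (by rw [← e]; simp only; omega))
    rw [← hj, Fin.insertNth_apply_succAbove]
    exact hD

/-- Both derivations kill 1, so the word survives only if `a` and `b` occupy exactly the slots 0 and
2s - 1. Since `q` counts slots with `p` removed, the two orders read (p, q) = (0, 2s - 2) and (2s -
1, 0). -/
theorem liftingWord_insertNth_insertNth {D D' : 𝔄 → 𝔄} (hD : D 1 = 0) (hD' : D' 1 = 0) {n s : ℕ}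
    (hs : 1 ≤ s) (hsn : 2 * s ≤ n + 2) (p : Fin (n + 2)) (q : Fin (n + 1)) (a b : 𝔄) :
    liftingWord D D' s (p.insertNth a (q.insertNth b 1 : Fin (n + 1) → 𝔄) : Fin (n + 2) → 𝔄) =
      (if p.val = 0 ∧ q.val + 2 = 2 * s then D a * D' b else 0) +
        if p.val + 1 = 2 * s ∧ q.val = 0 then D b * D' a else 0 := by
  have key : ∀ (c x : 𝔄) (r : Fin (n + 1)),
      liftingWord D D' s (Fin.cons c (r.insertNth x 1 : Fin (n + 1) → 𝔄) : Fin (n + 2) → 𝔄) =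
        D c * if r.val + 2 = 2 * s then D' x else 0 := by
    intro c x r
    rw [liftingWord, List.ofFn_succ, List.prod_cons, ← prod_ofFn_modify_insertNth hD' hs hsn]
    simp [add_assoc]
  induction p using Fin.cases with
  | zero =>
    have h : ¬((0 : Fin (n + 2)).val + 1 = 2 * s ∧ q.val = 0) := fun h => by
      have := h.1
      rw [Fin.val_zero] at this
      omega
    rw [Fin.insertNth_zero', key, if_neg h, add_zero]
    simp
  | succ p =>
    rw [if_neg (by simp), zero_add]
    by_cases hq : q.val = 0
    · obtain rfl : q = 0 := Fin.ext hq
      have : (p.succ.insertNth a ((0 : Fin (n + 1)).insertNth b 1 : Fin (n + 1) → 𝔄) :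
          Fin (n + 2) → 𝔄) = Fin.cons b (p.insertNth a 1 : Fin (n + 1) → 𝔄) := by
        rw [Fin.insertNth_zero', Fin.insertNth_succ_cons]
      rw [this, key]
      simp [add_assoc]
    -- Neither `a` nor `b` is the first letter, so `D` acts on 1 there.
    · rw [if_neg (by tauto)]
      refine prod_ofFn_eq_zero 0 ?_
      have h0 : (p.succ.insertNth a (q.insertNth b 1 : Fin (n + 1) → 𝔄) : Fin (n + 2) → 𝔄) 0 = 1 := by
        have e1 : (0 : Fin (n + 2)) = p.succ.succAbove 0 := by simp
        obtain ⟨j, hj⟩ := Fin.exists_succAbove_eq (x := 0) (y := q) (fun e => hq (by rw [← e]; rfl))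
        rw [e1, Fin.insertNth_apply_succAbove, ← hj, Fin.insertNth_apply_succAbove]
        rfl
      rw [h0]
      simpa using hD

end LiftingWord

/-! ### Signed counts of slots and the sum of the weights -/

section Signs

theorem sum_range_alternating_ge (k p : ℕ) :
    ∑ q ∈ Finset.range (2 * k), (if p ≤ q then (-1 : ℂ) ^ q else 0) =
      if p < 2 * k ∧ p % 2 = 1 then -1 else 0 := by
  induction k with
  | zero => simp
  | succ k ih =>
    rw [show 2 * (k + 1) = 2 * k + 1 + 1 by ring, Finset.sum_range_succ, Finset.sum_range_succ, ih,
      pow_succ, pow_mul, neg_one_sq, one_pow]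
    split_ifs <;> first | omega | norm_num

theorem sum_range_odd (k : ℕ) :
    ∑ p ∈ Finset.range (2 * k + 1), (if p % 2 = 1 then (1 : ℂ) else 0) = k := by
  induction k with
  | zero => simp
  | succ k ih =>
    rw [show 2 * (k + 1) + 1 = 2 * k + 1 + 1 + 1 by ring, Finset.sum_range_succ,
      Finset.sum_range_succ, ih, if_pos (by omega), if_neg (by omega)]
    push_cast
    ring

/-- For fixed `p` the full alternating sum over the 2k values of `q` is 0, which removes `v` and
leaves u - v times the tail q ≥ p. That tail is 0 for even `p` and -1 for odd `p`, so each of the k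
odd values of `p` contributes (-1)(-1) = 1. -/
theorem sum_sign_insertNth_insertNth (k : ℕ) (u v : ℂ) :
    ∑ p : Fin (2 * k + 1), ∑ q : Fin (2 * k), (-1 : ℂ) ^ p.val * ((-1 : ℂ) ^ q.val *
      if p.val ≤ q.val then u else v) = k * (u - v) := by
  rw [Fin.sum_univ_eq_sum_range (fun p => ∑ q : Fin (2 * k), (-1 : ℂ) ^ p * ((-1 : ℂ) ^ q.val *
      if p ≤ q.val then u else v)), ← sum_range_odd, Finset.sum_mul]
  refine Finset.sum_congr rfl fun p hp => ?_
  rw [Finset.mem_range] at hp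
  rw [Fin.sum_univ_eq_sum_range (fun q => (-1 : ℂ) ^ p * ((-1 : ℂ) ^ q * if p ≤ q then u else v)),
    ← Finset.mul_sum]
  have h0 : ∑ q ∈ Finset.range (2 * k), (-1 : ℂ) ^ q = 0 := by
    simp
  have h1 : ∀ q, (-1 : ℂ) ^ q * (if p ≤ q then u else v) =
      (if p ≤ q then (-1 : ℂ) ^ q else 0) * (u - v) + (-1 : ℂ) ^ q * v := by
    intro q
    split_ifs <;> ring
  rw [Finset.sum_congr rfl fun q _ => h1 q, Finset.sum_add_distrib, ← Finset.sum_mul,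
    ← Finset.sum_mul, h0, sum_range_alternating_ge]
  by_cases hodd : p % 2 = 1
  · rw [if_pos ⟨by omega, hodd⟩, if_pos hodd, (Nat.odd_iff.2 hodd).neg_one_pow]
    ring
  · rw [if_neg (by tauto), if_neg hodd]
    ring

/-- Just two pairs of slots contribute: (0, 2s - 2) with even sum of slots, and (2s - 1, 0) with odd
sum. -/
theorem sum_sign_liftingWord {k s : ℕ} (hs : s ∈ Finset.Icc 1 k) (u v : ℂ) :
    ∑ p : Fin (2 * k + 1), ∑ q : Fin (2 * k), (-1 : ℂ) ^ p.val * ((-1 : ℂ) ^ q.val *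
      ((if p.val = 0 ∧ q.val + 2 = 2 * s then u else 0) +
        if p.val + 1 = 2 * s ∧ q.val = 0 then v else 0)) = u - v := by
  rw [Finset.mem_Icc] at hs
  simp only [mul_add, Finset.sum_add_distrib]
  rw [sub_eq_add_neg]
  congr 1
  · rw [Finset.sum_eq_single (⟨0, by omega⟩ : Fin (2 * k + 1)),
      Finset.sum_eq_single (⟨2 * s - 2, by omega⟩ : Fin (2 * k))]
    · have h : (-1 : ℂ) ^ (2 * s - 2) = 1 := Even.neg_one_pow ⟨s - 1, by omega⟩
      rw [if_pos ⟨rfl, by simp only; omega⟩, h, pow_zero, one_mul, one_mul]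
    · intro q _ hq
      rw [if_neg fun h => hq (Fin.ext (by simp only; omega)), mul_zero, mul_zero]
    · simp
    · intro p _ hp
      refine Finset.sum_eq_zero fun q _ => ?_
      rw [if_neg fun h => hp (Fin.ext h.1), mul_zero, mul_zero]
    · simp
  · rw [Finset.sum_eq_single (⟨2 * s - 1, by omega⟩ : Fin (2 * k + 1)),
      Finset.sum_eq_single (⟨0, by omega⟩ : Fin (2 * k))]
    · have h : (-1 : ℂ) ^ (2 * s - 1) = -1 := Odd.neg_one_pow ⟨s - 1, by omega⟩
      rw [if_pos ⟨by simp only; omega, rfl⟩, h, pow_zero, one_mul, neg_one_mul]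
    · intro q _ hq
      rw [if_neg fun h => hq (Fin.ext h.2), mul_zero, mul_zero]
    · simp
    · intro p _ hp
      refine Finset.sum_eq_zero fun q _ => ?_
      rw [if_neg fun h => hp (Fin.ext (by simp only; omega)), mul_zero, mul_zero]
    · simp

/-- For k = 2j there are j weights 1 and one weight 1/2 at s = j + 1; for k = 2j + 1 there are j + 1
weights 1. For k = 0 the range is empty and the formula fails. -/
theorem sum_liftingWeight (k : ℕ) (hk : 1 ≤ k) :
    ∑ s ∈ Finset.Icc 1 k, liftingWeight k s = (k + 1) / 2 := by
  have hone : ∀ j, 2 * j ≤ k + 1 → ∑ s ∈ Finset.Icc 1 j, liftingWeight k s = j := by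
    intro j hj
    rw [Finset.sum_congr rfl fun s hs => by
      rw [liftingWeight, if_pos (by rw [Finset.mem_Icc] at hs; omega)]]
    simp
  have hsub : ∀ j, j ≤ k → k + 2 < 2 * (j + 1) →
      ∑ s ∈ Finset.Icc 1 k, liftingWeight k s = ∑ s ∈ Finset.Icc 1 j, liftingWeight k s := by
    intro j hj hj'
    refine (Finset.sum_subset (Finset.Icc_subset_Icc_right hj) fun s hs hs' => ?_).symm
    rw [Finset.mem_Icc] at hs hs'
    rw [liftingWeight, if_neg (by omega), if_neg (by omega)]
  obtain ⟨j, hj | hj⟩ := Nat.even_or_odd' k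
  · rw [hsub (j + 1) (by omega) (by omega), Finset.sum_Icc_succ_top (by omega), hone j (by omega),
      liftingWeight, if_neg (by omega), if_pos (by omega), hj]
    push_cast
    ring
  · rw [hsub (j + 1) (by omega) (by omega), hone (j + 1) (by omega), hj]
    push_cast
    ring

end Signs

/-! ### Separation of operators and numerical matrices -/

theorem PsiDif.smul_mul_smul' (a b : ℂ) (P S : PsiDif) : (a • P) * (b • S) = (a * b) • (P * S) := by
  rw [← const_mul a P, ← mul_const b S, mul_assoc, ← mul_assoc P, mul_const, const_mul, smul_smul]

namespace InfMat

/-- The matrix `P ⊗ M` with entries `Mᵢⱼ P`. -/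
def tensor (P : PsiDif) (M : InfMat ℂ) : InfMat PsiDif := M.map (fun c => c • P) (zero_smul ℂ P)

theorem tensor_mul_tensor (P S : PsiDif) (M N : InfMat ℂ) :
    tensor P M * tensor S N = tensor (P * S) (M * N) := by
  ext1
  funext i j
  have hs : ∀ l, M.entry i l ≠ 0 → l ∈ (M.row_finite i).toFinset := fun l hl => by simpa using hl
  rw [mul_entry_eq_row (tensor P M) (tensor S N) i j (M.row_finite i).toFinset]
  · change ∑ l ∈ _, (M.entry i l • P) * (N.entry l j • S) = (M * N).entry i j • (P * S)
    rw [mul_entry_eq_row M N i j _ hs, Finset.sum_smul]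
    exact Finset.sum_congr rfl fun l _ => smul_mul_smul' ..
  · intro l hl
    exact hs l fun h => hl (by change M.entry i l • P = 0; rw [h, zero_smul])

theorem tensor_one (P : PsiDif) : tensor P 1 = scalar P := by
  ext1
  funext i j
  change (if i = j then (1 : ℂ) else 0) • P = if i = j then P else 0
  split_ifs <;> simp

theorem prod_ofFn_tensor {n : ℕ} (P : Fin n → PsiDif) (M : Fin n → InfMat ℂ) :
    (List.ofFn fun j => tensor (P j) (M j)).prod = tensor (List.ofFn P).prod (List.ofFn M).prod := by
  induction n with
  | zero => exact (tensor_one 1).symm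
  | succ n ih => simp only [List.ofFn_succ, List.prod_cons, ← tensor_mul_tensor, ih]

theorem tensorOne_eq (A : glFin) : tensorOne A = tensor 1 A := by
  ext1
  funext i j
  change const _ = _ • (1 : PsiDif)
  rw [← const_mul, mul_one]

theorem map_tensor (D : PsiDif →+ PsiDif) (hD : ∀ (c : ℂ) P, D (c • P) = c • D P) (P : PsiDif)
    (M : InfMat ℂ) : (tensor P M).map D (map_zero D) = tensor (D P) M := by
  ext1
  funext i j
  exact hD _ _

/-- No finiteness is needed: either the residue is 0 and both sides vanish, or the two diagonal
families have the same support. -/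
theorem trace_tensor (P : PsiDif) (M : InfMat ℂ) : trace res (tensor P M) = res P * trace id M := by
  rw [trace, trace, mul_finsum]
  refine finsum_congr fun i => ?_
  change res (M.entry i i • P) = _
  rw [res_smul, mul_comm, id]

theorem liftingWord_tensor (D D' : PsiDif →+ PsiDif) (hD : ∀ (c : ℂ) P, D (c • P) = c • D P)
    (hD' : ∀ (c : ℂ) P, D' (c • P) = c • D' P) (s : ℕ) {n : ℕ} (P : Fin n → PsiDif)
    (M : Fin n → InfMat ℂ) :
    liftingWord (InfMat.map D (map_zero D)) (InfMat.map D' (map_zero D')) s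
        (fun j => tensor (P j) (M j)) =
      tensor (liftingWord D D' s P) (List.ofFn M).prod := by
  rw [liftingWord, liftingWord, ← prod_ofFn_tensor]
  congr 2
  funext j
  rw [map_tensor D hD, map_tensor D' hD']
  split_ifs <;> rfl

/-- The two scalar arguments carry the identity matrix and the other arguments carry the operator 1.
Once the slots of the former are fixed, the operator word no longer depends on how the latter are
permuted, so it comes out of the inner alternation. -/
theorem alternate_tensor {n : ℕ} (F : (Fin (n + 2) → InfMat PsiDif) → ℂ)
    (G : (Fin (n + 2) → PsiDif) → ℂ)
    (hFG : ∀ (P : Fin (n + 2) → PsiDif) (M : Fin (n + 2) → InfMat ℂ),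
      F (fun j => tensor (P j) (M j)) = G P * trace id (List.ofFn M).prod)
    (a b : PsiDif) (B : Fin n → InfMat ℂ) :
    alternate F (Fin.cons (scalar a) (Fin.cons (scalar b) fun j => tensor 1 (B j) :
        Fin (n + 1) → InfMat PsiDif) : Fin (n + 2) → InfMat PsiDif) =
      (∑ p : Fin (n + 2), ∑ q : Fin (n + 1), (-1 : ℂ) ^ p.val * ((-1 : ℂ) ^ q.val *
        G (p.insertNth a (q.insertNth b 1 : Fin (n + 1) → PsiDif) : Fin (n + 2) → PsiDif))) *
      alternate (fun B => trace id (List.ofFn B).prod) B := by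
  have hins : ∀ {m : ℕ} (p : Fin (m + 1)) (P : Fin m → PsiDif) (M : Fin m → InfMat ℂ) (c : PsiDif),
      (p.insertNth (scalar c) (fun j => tensor (P j) (M j)) : Fin (m + 1) → InfMat PsiDif) =
        fun j => tensor ((p.insertNth c P : Fin (m + 1) → PsiDif) j)
          ((p.insertNth 1 M : Fin (m + 1) → InfMat ℂ) j) := by
    intro m p P M c
    funext j
    induction j using p.succAboveCases with
    | x => simp [tensor_one]
    | p j => simp
  rw [alternate_cons, Finset.sum_mul]
  refine Finset.sum_congr rfl fun p _ => ?_
  rw [alternate_cons, Finset.smul_sum, Finset.sum_mul]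
  refine Finset.sum_congr rfl fun q _ => ?_
  have hval : ∀ w : Fin n → InfMat ℂ,
      F (p.insertNth (scalar a) (q.insertNth (scalar b) fun j => tensor 1 (w j) :
        Fin (n + 1) → InfMat PsiDif)) =
      G (p.insertNth a (q.insertNth b 1 : Fin (n + 1) → PsiDif)) *
        trace id (List.ofFn w).prod := by
    intro w
    have h := hins q 1 w b
    simp only [Pi.one_apply] at h
    rw [h, hins p, hFG, prod_ofFn_insertNth_one, prod_ofFn_insertNth_one]
  have hcomp : alternate (fun w => F (p.insertNth (scalar a) (q.insertNth (scalar b) w :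
        Fin (n + 1) → InfMat PsiDif))) (fun j => tensor 1 (B j)) =
      alternate (fun w => F (p.insertNth (scalar a) (q.insertNth (scalar b) fun j => tensor 1 (w j) :
        Fin (n + 1) → InfMat PsiDif))) B := rfl
  rw [hcomp]
  simp only [hval]
  rw [alternate_mul_left, zsmul_eq_mul, zsmul_eq_mul]
  push_cast
  ring

end InfMat

open InfMat

/-! ### Evaluation of the contracted cochain -/

theorem PsiContracted_succ (m : ℕ) (A : Fin (2 * m + 1) → glFin) :
    PsiContracted (m + 1) A = -(2 * (m + 1 : ℕ) + 1 : ℂ) *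
      alternate (fun B : Fin (2 * m + 1) → InfMat ℂ => trace id (List.ofFn B).prod)
        fun j => (A j : InfMat ℂ) := by
  have hargs : (fun j : Fin (2 * (m + 1) + 1) =>
      if j.val = 0 then InfMat.scalar PsiDif.d
      else if h : 2 ≤ j.val then tensorOne (A ⟨j.val - 2, by omega⟩)
      else InfMat.scalar PsiDif.x2d) =
      (Fin.cons (scalar d) (Fin.cons (scalar x2d) fun j => tensor 1 (A j : InfMat ℂ) :
        Fin (2 * m + 1 + 1) → InfMat PsiDif) : Fin (2 * m + 1 + 2) → InfMat PsiDif) := by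
    funext j
    -- 2(m + 1) + 1 and 2m + 1 + 2 agree only after unfolding; this form exposes the two leading
    -- arguments.
    change Fin (2 * m + 1 + 2) at j
    induction j using Fin.cases with
    | zero => rfl
    | succ j =>
      induction j using Fin.cases with
      | zero => rfl
      | succ j =>
        simp only [Fin.cons_succ]
        rw [← tensorOne_eq, if_neg (by simp), dif_pos (by simp)]
        rfl
  rw [PsiContracted, Psi, lifting]
  erw [hargs]
  set t := alternate (fun B : Fin (2 * m + 1) → InfMat ℂ => trace id (List.ofFn B).prod)
        fun j => (A j : InfMat ℂ) with ht
  have hQ : alternate (fun B => trace res (scalar Q * (List.ofFn B).prod))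
      (Fin.cons (scalar d) (Fin.cons (scalar x2d) fun j => tensor 1 (A j : InfMat ℂ) :
        Fin (2 * m + 1 + 1) → InfMat PsiDif) : Fin (2 * m + 1 + 2) → InfMat PsiDif) =
      -((m + 1 : ℕ) : ℂ) * t := by
    rw [alternate_tensor _ (fun P => res (Q * (List.ofFn P).prod))]
    · simp only [prod_ofFn_insertNth_insertNth]
      have := sum_sign_insertNth_insertNth (m + 1) (res (Q * (d * x2d))) (res (Q * (x2d * d)))
      rw [res_Q_mul_commutator, mul_neg_one] at this
      rw [← this]
      simp only [apply_ite (fun P => res (Q * P))]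
      rfl
    · intro P M
      rw [prod_ofFn_tensor, ← tensor_one, tensor_mul_tensor, one_mul, trace_tensor]
  have hW : ∀ s ∈ Finset.Icc 1 (m + 1), alternate (fun B =>
        trace res (liftingWord (InfMat.map adLogD (map_zero _)) (InfMat.map adLogX (map_zero _)) s B) -
        trace res (liftingWord (InfMat.map adLogX (map_zero _)) (InfMat.map adLogD (map_zero _)) s B))
      (Fin.cons (scalar d) (Fin.cons (scalar x2d) fun j => tensor 1 (A j : InfMat ℂ) :
        Fin (2 * m + 1 + 1) → InfMat PsiDif) : Fin (2 * m + 1 + 2) → InfMat PsiDif) = -2 * t := by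
    intro s hs
    rw [alternate_tensor _
      (fun P => res (liftingWord adLogD adLogX s P) - res (liftingWord adLogX adLogD s P))]
    -- With ∂ first and x²∂ in slot 2s - 1 only the subtracted word D₂∂ · D₁(x²∂) survives, giving
    -- -1. In the opposite order only D₁(x²∂) · D₂∂ survives, giving 1.
    · have h := sum_sign_liftingWord hs (-1) 1
      rw [show (-1 - 1 : ℂ) = -2 by norm_num] at h
      rw [← h]
      congr 1
      rw [Finset.mem_Icc] at hs
      refine Finset.sum_congr rfl fun p _ => Finset.sum_congr rfl fun q _ => ?_
      rw [liftingWord_insertNth_insertNth adLogD_one adLogX_one hs.1 (by omega),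
        liftingWord_insertNth_insertNth adLogX_one adLogD_one hs.1 (by omega), adLogD_d]
      congr 2
      simp only [zero_mul, mul_zero, ite_self, zero_add, add_zero, apply_ite res,
        res_adLogD_x2d_mul_adLogX_d, res_adLogX_d_mul_adLogD_x2d, res_zero]
      split_ifs <;> first | (exfalso; omega) | norm_num
    · intro P M
      rw [liftingWord_tensor _ _ adLogD_smul adLogX_smul,
        liftingWord_tensor _ _ adLogX_smul adLogD_smul, trace_tensor, trace_tensor, sub_mul]
  have hS := Finset.sum_congr rfl fun s hs => congrArg (liftingWeight (m + 1) s * ·) (hW s hs)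
  erw [hQ, hS]
  rw [← Finset.sum_mul, sum_liftingWeight _ (by omega)]
  push_cast
  ring

/-! ### Additivity of the trace on finite matrices -/

theorem InfMat.IsFin.prod_ofFn {n : ℕ} {B : Fin (n + 1) → InfMat ℂ} (hB : ∀ j, (B j).IsFin) :
    (List.ofFn B).prod.IsFin := by
  induction n with
  | zero => simpa using hB 0
  | succ n ih =>
    rw [List.ofFn_succ, List.prod_cons]
    exact (hB 0).mul (ih fun j => hB j.succ)

/-- The trace of matrices with finitely many nonzero entries. -/
def glFin.traceHom : glFin →+ ℂ where
  toFun A := trace id (A : InfMat ℂ)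
  map_zero' := finsum_eq_zero_of_forall_eq_zero fun _ => rfl
  map_add' A B := by
    have h : ∀ C : glFin, (Function.support fun i => id ((C : InfMat ℂ).entry i i)).Finite :=
      fun C => (C.2.image Prod.fst).subset fun i hi => ⟨(i, i), hi, rfl⟩
    exact finsum_add_distrib (h A) (h B)

/-- An infinite diagonal sum has the default value 0, so additivity has to be taken inside `glFin`.
-/
theorem trace_sum_smul {ι : Type*} (s : Finset ι) (z : ι → ℤ) (M : ι → InfMat ℂ)
    (hM : ∀ i, (M i).IsFin) :
    trace id (∑ i ∈ s, z i • M i) = ∑ i ∈ s, z i • trace id (M i) := by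
  have h : ∑ i ∈ s, z i • M i = ((∑ i ∈ s, z i • (⟨M i, hM i⟩ : glFin) : glFin) : InfMat ℂ) := by
    push_cast
    rfl
  rw [h]
  change glFin.traceHom _ = _
  rw [map_sum]
  exact Finset.sum_congr rfl fun i _ => map_zsmul ..

theorem trace_sum_alternate_prod {ι : Type*} (s : Finset ι) {n : ℕ}
    (A : ι → Fin (n + 1) → glFin) :
    trace id (∑ i ∈ s, alternate (fun B : Fin (n + 1) → InfMat ℂ => (List.ofFn B).prod)
        fun j => (A i j : InfMat ℂ)) =
      ∑ i ∈ s, alternate (fun B : Fin (n + 1) → InfMat ℂ => trace id (List.ofFn B).prod)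
        fun j => (A i j : InfMat ℂ) := by
  simp only [alternate]
  rw [← Finset.sum_product', trace_sum_smul _ (fun x : ι × _ => (Equiv.Perm.sign x.2 : ℤ))
    (fun x => (List.ofFn ((fun j => (A x.1 j : InfMat ℂ)) ∘ x.2)).prod), Finset.sum_product]
  exact fun x => IsFin.prod_ofFn fun j => (A x.1 _).2

/-! ### Recursion for the Chevalley–Eilenberg boundary -/

section Boundary

open ExteriorAlgebra (ι)

variable {L : Type*} [LieRing L] [LieAlgebra ℂ L]

/-- The product `x₁ ∧ … ∧ x_n`. -/
def wedge {n : ℕ} (x : Fin n → L) : ExteriorAlgebra ℂ L := (List.ofFn fun t => ι ℂ (x t)).prod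

/-- The action `∑ⱼ x₁ ∧ … ∧ [y, xⱼ] ∧ … ∧ x_n` of `y` on `x₁ ∧ … ∧ x_n`. -/
def lieWedge (y : L) {n : ℕ} (x : Fin n → L) : ExteriorAlgebra ℂ L :=
  ∑ j, wedge (Function.update x j ⁅y, x j⁆)

theorem wedge_cons {n : ℕ} (a : L) (w : Fin n → L) :
    wedge (Fin.cons a w : Fin (n + 1) → L) = ι ℂ a * wedge w := by
  simp [wedge, List.ofFn_succ]

theorem lieWedge_cons {n : ℕ} (y a : L) (w : Fin n → L) :
    lieWedge y (Fin.cons a w : Fin (n + 1) → L) =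
      ι ℂ ⁅y, a⁆ * wedge w + ι ℂ a * lieWedge y w := by
  simp only [lieWedge, Fin.sum_univ_succ, Fin.cons_zero, Fin.cons_succ, Fin.update_cons_zero,
    ← Fin.cons_update, wedge_cons, Finset.mul_sum]

theorem ι_mul_ι_eq_neg (x y : L) : ι ℂ x * ι ℂ y = -(ι ℂ y * ι ℂ x) :=
  eq_neg_of_add_eq_zero_left (ExteriorAlgebra.ι_add_mul_swap x y)

/-- Moving `y` from the front into the vacated place `b` passes `b` factors, each of which changes
the sign. -/
theorem neg_one_pow_smul_ι_mul_prod_ne {n : ℕ} (y : L) (w : Fin n → L) (b : Fin n) :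
    (-1 : ℂ) ^ b.val • (ι ℂ y * (((List.finRange n).filter fun l => l ≠ b).map
      fun l => ι ℂ (w l)).prod) = wedge (Function.update w b y) := by
  induction n with
  | zero => exact b.elim0
  | succ n ih =>
    rw [← Fin.cons_self_tail w]
    generalize w 0 = a
    generalize Fin.tail w = v
    rw [List.finRange_succ]
    induction b using Fin.cases with
    | zero =>
      rw [Fin.update_cons_zero, wedge_cons, List.filter_cons_of_neg (by simp), List.filter_map,
        List.map_map, List.filter_eq_self.2 (by simp)]
      simp [wedge, Function.comp_def, List.ofFn_eq_map]
    | succ b =>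
      rw [← Fin.cons_update, wedge_cons, ← ih,
        List.filter_cons_of_pos (by simpa using (Fin.succ_ne_zero b).symm), List.filter_map,
        List.map_cons, List.prod_cons, List.map_map, ← mul_assoc, ι_mul_ι_eq_neg, Fin.val_succ,
        pow_succ, mul_neg_one, neg_smul, neg_mul, smul_neg, neg_neg, mul_smul_comm, mul_assoc]
      simp [Function.comp_def]

/-- The pairs containing the first index assemble into the action of `a` on the rest. In the other
pairs both indices shift by one, which preserves the sign, while `a` passes the bracket once. -/
theorem boundary_cons {n : ℕ} (a : L) (w : Fin n → L) :
    boundary (Fin.cons a w : Fin (n + 1) → L) = -lieWedge a w - ι ℂ a * boundary w := by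
  rw [boundary, Fin.sum_univ_succ, sub_eq_add_neg]
  congr 1
  · rw [Fin.Ioi_zero_eq_map, Finset.sum_map, lieWedge, ← Finset.sum_neg_distrib]
    refine Finset.sum_congr rfl fun b _ => ?_
    rw [← neg_one_pow_smul_ι_mul_prod_ne, List.finRange_succ, List.filter_cons_of_neg (by simp),
      List.filter_map, List.map_map]
    simp [pow_succ, Function.comp_def]
  · rw [boundary, Finset.mul_sum, ← Finset.sum_neg_distrib]
    refine Finset.sum_congr rfl fun c _ => ?_
    rw [← Fin.map_succEmb_Ioi, Finset.sum_map, Finset.mul_sum, ← Finset.sum_neg_distrib]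
    refine Finset.sum_congr rfl fun b _ => ?_
    rw [List.finRange_succ, List.filter_cons_of_pos (by simp [eq_comm]),
      List.filter_map, List.map_cons, List.prod_cons, List.map_map, ← mul_assoc, ι_mul_ι_eq_neg,
      mul_smul_comm, neg_mul, smul_neg, mul_assoc]
    simp [Function.comp_def]
    ring_nf

theorem boundary_fin_zero (x : Fin 0 → L) : boundary x = 0 := by
  simp [boundary]

end Boundary

/-! ### Nonvanishing from a sum of squares -/

section Symmetrization

theorem alternate_comp_perm {α : Type*} {n : ℕ} (c : (Fin n → α) → ℤ) (I : Fin n → α)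
    (σ : Equiv.Perm (Fin n)) :
    alternate c (I ∘ σ) = (Equiv.Perm.sign σ : ℤ) * alternate c I := by
  rw [alternate, alternate, Finset.mul_sum, ← (Group.mulLeft_bijective σ⁻¹).sum_comp]
  refine Finset.sum_congr rfl fun τ _ => ?_
  rw [Function.comp_assoc, ← Equiv.Perm.coe_mul, mul_inv_cancel_left, Equiv.Perm.sign_mul,
    Equiv.Perm.sign_inv]
  push_cast
  rw [smul_eq_mul, smul_eq_mul, mul_assoc]

/-- The signs in c(I∘σ) and Alt c(I∘σ) combine so that (Alt c(I))² = ∑_σ c(I∘σ) Alt c(I∘σ). Summing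
over I, each σ gives the same sum after reindexing, so n! times the sum in question is a sum of
integer squares. -/
theorem sum_mul_alternate_ne_zero {α : Type*} [Fintype α] {n : ℕ} (c : (Fin n → α) → ℤ)
    (I₀ : Fin n → α) (h : alternate c I₀ ≠ 0) : ∑ I, c I * alternate c I ≠ 0 := by
  have h1 : ∑ I, alternate c I ^ 2 =
      ∑ _σ : Equiv.Perm (Fin n), ∑ I, c I * alternate c I := by
    have h2 : ∀ I, alternate c I ^ 2 =
        ∑ σ : Equiv.Perm (Fin n), c (I ∘ σ) * alternate c (I ∘ σ) := by
      intro I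
      rw [sq]
      nth_rw 1 [alternate]
      rw [Finset.sum_mul]
      refine Finset.sum_congr rfl fun σ _ => ?_
      rw [alternate_comp_perm, smul_eq_mul]
      ring
    rw [Finset.sum_congr rfl fun I _ => h2 I, Finset.sum_comm]
    refine Finset.sum_congr rfl fun σ _ => ?_
    exact (σ.arrowCongr (Equiv.refl α)).symm.sum_comp fun I => c I * alternate c I
  intro h0
  rw [h0, Finset.sum_const_zero, Finset.sum_eq_zero_iff_of_nonneg fun _ _ => sq_nonneg _] at h1
  exact h (pow_eq_zero_iff two_ne_zero |>.1 (h1 I₀ (Finset.mem_univ _)))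

end Symmetrization

/-! ### Matrix units -/

/-- The matrix unit with a one in row `a` and column `b`. -/
def InfMat.unit (a b : ℕ) : InfMat ℂ where
  entry i j := if i = a ∧ j = b then 1 else 0
  row_finite _ := (Set.finite_singleton b).subset fun j hj => by
    by_contra h
    exact hj (if_neg fun e => h e.2)
  col_finite _ := (Set.finite_singleton a).subset fun i hi => by
    by_contra h
    exact hi (if_neg fun e => h e.1)

theorem InfMat.unit_entry (a b i j : ℕ) :
    (InfMat.unit a b).entry i j = if i = a ∧ j = b then 1 else 0 := rfl

theorem InfMat.zero_entry (i j : ℕ) : (0 : InfMat ℂ).entry i j = 0 := rfl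

theorem InfMat.one_entry (i j : ℕ) : (1 : InfMat ℂ).entry i j = if i = j then 1 else 0 := rfl

theorem InfMat.isFin_unit (a b : ℕ) : (InfMat.unit a b).IsFin :=
  (Set.finite_singleton (a, b)).subset fun p hp => by
    by_contra h
    exact hp (if_neg fun e => h (Prod.ext e.1 e.2))

theorem InfMat.unit_mul_entry (a b i j : ℕ) (M : InfMat ℂ) :
    (InfMat.unit a b * M).entry i j = if i = a then M.entry b j else 0 := by
  rw [mul_entry_eq_row _ _ _ _ {b}]
  · simp [InfMat.unit_entry]
  · intro l hl
    rw [InfMat.unit_entry] at hl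
    exact Finset.mem_singleton.2 (by_contra fun h => hl (if_neg fun e => h e.2))

theorem InfMat.unit_mul_unit (a b c e : ℕ) :
    InfMat.unit a b * InfMat.unit c e = if b = c then InfMat.unit a e else 0 := by
  ext i j
  rw [InfMat.unit_mul_entry]
  split_ifs with h1 h2 h2 <;> simp [InfMat.unit_entry, InfMat.zero_entry, h1, h2]

theorem InfMat.trace_unit (a b : ℕ) : trace id (InfMat.unit a b) = if b = a then 1 else 0 := by
  rw [trace, finsum_eq_single _ a]
  · simp [InfMat.unit_entry, eq_comm]
  · intro i hi
    simp [InfMat.unit_entry, hi]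

/-- The matrix unit with a one in row `a` and column `b`, as an element of `glFin`. -/
def glFin.unit (a b : ℕ) : glFin := ⟨InfMat.unit a b, InfMat.isFin_unit a b⟩

theorem glFin.unit_lie_unit (a b c e : ℕ) :
    ⁅glFin.unit a b, glFin.unit c e⁆ =
      (if b = c then glFin.unit a e else 0) - if e = a then glFin.unit c b else 0 := by
  apply Subtype.ext
  change InfMat.unit a b * InfMat.unit c e - InfMat.unit c e * InfMat.unit a b = _
  rw [InfMat.unit_mul_unit, InfMat.unit_mul_unit]
  push_cast
  split_ifs <;> rfl

theorem glFin.E11_eq : glFin.E11 = glFin.unit 0 0 := rfl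

/-! ### Sums over paths as powers of a matrix over the exterior algebra -/

section Paths

variable {N : ℕ}

/-- The tuple of matrix units with the given rows and columns. -/
def units {n : ℕ} (I : Fin n → Fin N × Fin N) : Fin n → glFin :=
  fun t => glFin.unit (I t).1 (I t).2

theorem units_cons {n : ℕ} (p : Fin N × Fin N) (I : Fin n → Fin N × Fin N) :
    units (Fin.cons p I : Fin (n + 1) → Fin N × Fin N) =
      (Fin.cons (glFin.unit p.1 p.2) (units I) : Fin (n + 1) → glFin) := by
  funext t
  refine Fin.cases ?_ (fun t => ?_) t <;> simp [units]

/-- The product of the matrix units with the given rows and columns. -/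
def unitsProd {n : ℕ} (I : Fin n → Fin N × Fin N) : InfMat ℂ :=
  (List.ofFn fun t => (units I t : InfMat ℂ)).prod

theorem unitsProd_cons {n : ℕ} (p : Fin N × Fin N) (I : Fin n → Fin N × Fin N) :
    unitsProd (Fin.cons p I : Fin (n + 1) → Fin N × Fin N) =
      InfMat.unit p.1 p.2 * unitsProd I := by
  rw [unitsProd, units_cons]
  simp [List.ofFn_succ, unitsProd, glFin.unit]

/-- The edges form a path: each of them starts where the previous one ends. -/
def IsPath {n : ℕ} (I : Fin (n + 1) → Fin N × Fin N) : Prop :=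
  ∀ t : Fin n, (I t.castSucc).2 = (I t.succ).1

/-- The edges form a closed path. -/
def IsClosedPath {n : ℕ} (I : Fin (n + 1) → Fin N × Fin N) : Prop :=
  IsPath I ∧ (I (Fin.last n)).2 = (I 0).1

open Classical in
theorem unitsProd_eq {n : ℕ} (I : Fin (n + 1) → Fin N × Fin N) :
    unitsProd I = if IsPath I then InfMat.unit (I 0).1 (I (Fin.last n)).2 else 0 := by
  induction n with
  | zero =>
    have h : IsPath I := fun t => t.elim0
    rw [if_pos h]
    simp [unitsProd, units, glFin.unit]
  | succ n ih =>
    have h : IsPath I ↔ (I 0).2 = (I 1).1 ∧ IsPath (Fin.tail I) :=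
      ⟨fun h => ⟨h 0, fun t => h t.succ⟩, fun h t => Fin.cases h.1 (fun t => h.2 t) t⟩
    conv_lhs => rw [← Fin.cons_self_tail I]
    rw [unitsProd_cons, ih]
    by_cases h2 : IsPath (Fin.tail I)
    · rw [if_pos h2, InfMat.unit_mul_unit, show Fin.tail I 0 = I 1 from rfl]
      by_cases h1 : (I 0).2 = (I 1).1
      · rw [if_pos (congrArg Fin.val h1), if_pos (h.2 ⟨h1, h2⟩)]
        rfl
      · rw [if_neg fun e => h1 (Fin.ext e), if_neg fun e => h1 (h.1 e).1]
    · rw [if_neg h2, mul_zero, if_neg fun e => h2 (h.1 e).2]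

open Classical in
theorem trace_unitsProd {n : ℕ} (I : Fin (n + 1) → Fin N × Fin N) :
    trace id (unitsProd I) = if IsClosedPath I then 1 else 0 := by
  rw [unitsProd_eq, IsClosedPath]
  by_cases h : IsPath I
  · rw [if_pos h, InfMat.trace_unit]
    simp [h, Fin.ext_iff]
  · rw [if_neg h, if_neg fun e => h e.1]
    exact finsum_eq_zero_of_forall_eq_zero fun _ => rfl

theorem sum_unitsProd_entry {n : ℕ} (I : Fin (n + 1) → Fin N × Fin N) :
    ∑ i : Fin N, (unitsProd I).entry i i = trace id (unitsProd I) := by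
  classical
  rw [unitsProd_eq]
  split_ifs with h
  · rw [InfMat.trace_unit, Finset.sum_eq_single (I 0).1]
    · simp [InfMat.unit_entry, eq_comm]
    · intro i _ hi
      rw [InfMat.unit_entry, if_neg fun e => hi (Fin.ext e.1)]
    · simp
  · exact (Finset.sum_eq_zero fun _ _ => rfl).trans
      (finsum_eq_zero_of_forall_eq_zero fun _ => rfl).symm

open ExteriorAlgebra (ι)

/-- The sum of `g` over the tuples of matrix units along the paths with `n` edges that lead
from `i` to `j`. -/
def pathSum {n : ℕ} (g : (Fin n → glFin) → ExteriorAlgebra ℂ glFin) :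
    Matrix (Fin N) (Fin N) (ExteriorAlgebra ℂ glFin) :=
  fun i j => ∑ I : Fin n → Fin N × Fin N, (unitsProd I).entry i j • g (units I)

theorem pathSum_zero (g : (Fin 0 → glFin) → ExteriorAlgebra ℂ glFin) (i j : Fin N) :
    pathSum g i j = if i = j then g ![] else 0 := by
  rw [pathSum, Fintype.sum_unique]
  change (1 : InfMat ℂ).entry i j • g _ = _
  rw [InfMat.one_entry, Subsingleton.elim (units _) ![]]
  simp [Fin.ext_iff]

theorem pathSum_succ {n : ℕ} (g : (Fin (n + 1) → glFin) → ExteriorAlgebra ℂ glFin)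
    (i j : Fin N) :
    pathSum g i j = ∑ l : Fin N, pathSum (fun w => g (Fin.cons (glFin.unit i l) w)) l j := by
  rw [pathSum, ← (Fin.consEquiv fun _ : Fin (n + 1) => Fin N × Fin N).sum_comp,
    Fintype.sum_prod_type, Fintype.sum_prod_type, Finset.sum_eq_single i]
  · refine Finset.sum_congr rfl fun l _ => Finset.sum_congr rfl fun I _ => ?_
    change (unitsProd (Fin.cons (i, l) I : Fin (n + 1) → Fin N × Fin N)).entry i j •
      g (units (Fin.cons (i, l) I : Fin (n + 1) → Fin N × Fin N)) = _
    rw [unitsProd_cons, units_cons, InfMat.unit_mul_entry, if_pos rfl]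
  · intro i' _ hi
    refine Finset.sum_eq_zero fun l _ => Finset.sum_eq_zero fun I _ => ?_
    change (unitsProd (Fin.cons (i', l) I : Fin (n + 1) → Fin N × Fin N)).entry i j • _ = _
    rw [unitsProd_cons, InfMat.unit_mul_entry, if_neg fun e => hi (Fin.ext e).symm, zero_smul]
  · simp

theorem pathSum_add {n : ℕ} (g h : (Fin n → glFin) → ExteriorAlgebra ℂ glFin) (i j : Fin N) :
    pathSum (fun w => g w + h w) i j = pathSum g i j + pathSum h i j := by
  simp only [pathSum, smul_add, Finset.sum_add_distrib]

theorem pathSum_sub {n : ℕ} (g h : (Fin n → glFin) → ExteriorAlgebra ℂ glFin) (i j : Fin N) :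
    pathSum (fun w => g w - h w) i j = pathSum g i j - pathSum h i j := by
  simp only [pathSum, smul_sub, Finset.sum_sub_distrib]

theorem pathSum_neg {n : ℕ} (g : (Fin n → glFin) → ExteriorAlgebra ℂ glFin) (i j : Fin N) :
    pathSum (fun w => -g w) i j = -pathSum g i j := by
  simp only [pathSum, smul_neg, Finset.sum_neg_distrib]

theorem pathSum_mul_left {n : ℕ} (c : ExteriorAlgebra ℂ glFin)
    (g : (Fin n → glFin) → ExteriorAlgebra ℂ glFin) (i j : Fin N) :
    pathSum (fun w => c * g w) i j = c * pathSum g i j := by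
  simp only [pathSum, Finset.mul_sum, mul_smul_comm]

variable (N) in
/-- The matrix of the generators `Eᵢⱼ` of the exterior algebra. -/
def generic : Matrix (Fin N) (Fin N) (ExteriorAlgebra ℂ glFin) :=
  fun i j => ι ℂ (glFin.unit i j)

theorem pathSum_wedge (n : ℕ) : pathSum (fun w : Fin n → glFin => wedge w) = generic N ^ n := by
  induction n with
  | zero =>
    ext i j
    rw [pathSum_zero, pow_zero, Matrix.one_apply]
    simp [wedge]
  | succ n ih =>
    ext i j
    rw [pathSum_succ, pow_succ', Matrix.mul_apply, ← ih]
    refine Finset.sum_congr rfl fun l _ => ?_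
    simp only [wedge_cons]
    rw [pathSum_mul_left]
    rfl

/-- The action of the matrix unit on the generic matrix X is the commutator [e, X], with e the
numerical matrix having a 1 in row `b`, column `a`. Being a derivation, it sends Xⁿ to [e, Xⁿ]: the
inner terms cancel and only the two endpoints of a path remain. -/
theorem pathSum_lieWedge (n : ℕ) (a b i j : Fin N) :
    pathSum (fun w : Fin n → glFin => lieWedge (glFin.unit a b) w) i j =
      (if b = i then (generic N ^ n) a j else 0) - if j = a then (generic N ^ n) i b else 0 := by
  induction n generalizing i with
  | zero =>
    rw [pathSum_zero, pow_zero, Matrix.one_apply, Matrix.one_apply]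
    simp only [lieWedge, Finset.univ_eq_empty, Finset.sum_empty, ite_self]
    split_ifs <;> simp_all
  | succ n ih =>
    have hlie : ∀ l : Fin N, ι ℂ ⁅glFin.unit a b, glFin.unit i l⁆ =
        (if b = i then generic N a l else 0) - if l = a then generic N i b else 0 := by
      intro l
      rw [glFin.unit_lie_unit, map_sub, apply_ite (ι ℂ), apply_ite (ι ℂ), map_zero]
      simp only [Fin.val_inj]
      rfl
    have hg : ∀ l : Fin N, ι ℂ (glFin.unit i l) = generic N i l := fun _ => rfl
    rw [pathSum_succ]
    simp only [lieWedge_cons, pathSum_add, pathSum_mul_left, ih, hlie, hg, pathSum_wedge]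
    simp only [sub_mul, mul_sub, ite_mul, mul_ite, zero_mul, mul_zero, Finset.sum_add_distrib,
      Finset.sum_sub_distrib, Finset.sum_ite_eq', Finset.sum_ite_eq, Finset.mem_univ, if_true,
      pow_succ', Matrix.mul_apply]
    split_ifs <;> simp
    abel

/-- The first edge E_{il} acts on paths starting at l. Summed over l, the starting-point terms give
N copies of Xⁿ, and the end-point terms give tr Xⁿ on the diagonal. -/
theorem pathSum_boundary_succ (n : ℕ) :
    pathSum (fun w : Fin (n + 1) → glFin => boundary w) =
      -(N • generic N ^ n) + Matrix.diagonal (fun _ => (generic N ^ n).trace) -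
        generic N * pathSum (fun w : Fin n → glFin => boundary w) := by
  ext i j
  rw [pathSum_succ, Matrix.sub_apply, Matrix.add_apply, Matrix.mul_apply, Matrix.diagonal_apply]
  simp only [boundary_cons, pathSum_sub, pathSum_neg, pathSum_mul_left, pathSum_lieWedge,
    Finset.sum_sub_distrib, Finset.sum_neg_distrib, if_true]
  congr 1
  rw [Finset.sum_const, Matrix.trace, Matrix.neg_apply, Matrix.smul_apply, neg_sub,
    Finset.card_univ, Fintype.card_fin, sub_eq_neg_add]
  congr 1
  by_cases h : i = j
  · simp [h]
  · simp [h, Ne.symm h]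

/-- Graded commutativity: an entry of the n-th power has degree n. -/
theorem generic_mul_pow_apply (n : ℕ) (a b i j : Fin N) :
    generic N a b * (generic N ^ n) i j = (-1) ^ n * ((generic N ^ n) i j * generic N a b) := by
  induction n generalizing i with
  | zero =>
    rw [pow_zero, Matrix.one_apply]
    split_ifs <;> simp
  | succ n ih =>
    rw [pow_succ', Matrix.mul_apply, Finset.mul_sum, Finset.sum_mul, Finset.mul_sum]
    refine Finset.sum_congr rfl fun l _ => ?_
    have h : generic N a b * generic N i l = -(generic N i l * generic N a b) :=
      ι_mul_ι_eq_neg _ _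
    rw [← mul_assoc, h, neg_mul, mul_assoc, ih, pow_succ, mul_neg_one, neg_mul, mul_assoc,
      ((Commute.neg_one_right (generic N i l)).pow_right n).left_comm]

theorem pow_apply_mul_pow_apply (m n : ℕ) (a b i j : Fin N) :
    (generic N ^ m) a b * (generic N ^ n) i j =
      (-1) ^ (m * n) * ((generic N ^ n) i j * (generic N ^ m) a b) := by
  induction m generalizing a with
  | zero =>
    rw [pow_zero, Matrix.one_apply]
    split_ifs <;> simp
  | succ m ih =>
    rw [pow_succ', Matrix.mul_apply, Finset.mul_sum, Finset.sum_mul, Finset.mul_sum]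
    refine Finset.sum_congr rfl fun l _ => ?_
    rw [mul_assoc, ih, ((Commute.neg_one_right (generic N a l)).pow_right (m * n)).left_comm,
      ← mul_assoc (generic N a l), generic_mul_pow_apply, add_mul, one_mul, pow_add]
    simp only [mul_assoc]

theorem trace_generic_pow_mul (m n : ℕ) :
    (generic N ^ m).trace * (generic N ^ n).trace =
      (-1) ^ (m * n) * ((generic N ^ n).trace * (generic N ^ m).trace) := by
  rw [Matrix.trace, Matrix.trace, Finset.sum_mul_sum, Finset.sum_mul_sum, Finset.mul_sum,
    Finset.sum_comm]
  simp only [Finset.mul_sum]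
  exact Finset.sum_congr rfl fun i _ => Finset.sum_congr rfl fun j _ =>
    pow_apply_mul_pow_apply ..

theorem eq_zero_of_eq_neg_self {V : Type*} [AddCommGroup V] [Module ℂ V] {x : V} (h : x = -x) :
    x = 0 := by
  have h2 : (2 : ℂ) • x = 0 := by
    rw [two_smul]
    exact eq_neg_iff_add_eq_zero.1 h
  exact (smul_eq_zero.1 h2).resolve_left two_ne_zero

/-- Cyclically moving one factor past an odd number of others changes the sign, so the trace is its
own negative. -/
theorem trace_generic_pow_even {n : ℕ} (hn : Even n) (h0 : n ≠ 0) :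
    (generic N ^ n).trace = 0 := by
  obtain ⟨m, rfl⟩ := Nat.exists_eq_succ_of_ne_zero h0
  have hm : Odd m := by
    rw [Nat.succ_eq_add_one, Nat.even_add_one] at hn
    exact Nat.not_even_iff_odd.1 hn
  have h : (generic N ^ (m + 1)).trace = -(generic N ^ (m + 1)).trace := by
    conv_lhs => rw [pow_succ']
    rw [pow_succ]
    simp only [Matrix.trace, Matrix.diag, Matrix.mul_apply]
    rw [Finset.sum_comm, ← Finset.sum_neg_distrib]
    refine Finset.sum_congr rfl fun i _ => ?_
    rw [← Finset.sum_neg_distrib]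
    refine Finset.sum_congr rfl fun j _ => ?_
    rw [generic_mul_pow_apply, hm.neg_one_pow, neg_one_mul]
  exact eq_zero_of_eq_neg_self h

theorem pathSum_boundary_eq (n : ℕ) :
    pathSum (fun w : Fin n → glFin => boundary w) = ∑ m ∈ Finset.range n,
      (-generic N) ^ m * (-(N • generic N ^ (n - 1 - m)) +
        Matrix.diagonal fun _ => (generic N ^ (n - 1 - m)).trace) := by
  induction n with
  | zero =>
    ext i j
    rw [pathSum_zero, boundary_fin_zero]
    simp
  | succ n ih =>
    rw [pathSum_boundary_succ, ih, Finset.sum_range_succ', add_comm, sub_eq_add_neg, Finset.mul_sum,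
      ← Finset.sum_neg_distrib]
    rw [add_comm]
    congr 1
    · refine Finset.sum_congr rfl fun m hm => ?_
      rw [Finset.mem_range] at hm
      rw [← neg_mul, ← mul_assoc, ← pow_succ', show n + 1 - 1 - (m + 1) = n - 1 - m by omega]
    · simp [add_comm]

theorem trace_neg_generic_pow_mul (n m : ℕ) (hm : m ≤ n) :
    ((-generic N) ^ m * (-(N • generic N ^ (n - m)) +
        Matrix.diagonal fun _ => (generic N ^ (n - m)).trace)).trace =
      (-1) ^ m * (-(N • (generic N ^ n).trace) +
        (generic N ^ m).trace * (generic N ^ (n - m)).trace) := by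
  have h : (generic N ^ m * (-(N • generic N ^ (n - m)) +
        Matrix.diagonal fun _ => (generic N ^ (n - m)).trace)).trace =
      -(N • (generic N ^ n).trace) + (generic N ^ m).trace * (generic N ^ (n - m)).trace := by
    rw [mul_add, Matrix.trace_add, mul_neg, mul_smul_comm, ← pow_add, Nat.add_sub_cancel' hm,
      Matrix.trace_neg, Matrix.trace_smul]
    congr 1
    rw [Matrix.trace, Matrix.trace.eq_1 (generic N ^ m), Finset.sum_mul]
    exact Finset.sum_congr rfl fun i _ => Matrix.mul_diagonal ..
  rcases Nat.even_or_odd m with he | ho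
  · rw [he.neg_pow, he.neg_one_pow, one_mul, h]
  · rw [ho.neg_pow, ho.neg_one_pow, neg_one_mul, neg_mul, Matrix.trace_neg, h]

/-- For n > 0 the term tr Xⁿ vanishes, and so does tr X^m tr X^{n-m} for even m, where one of the
exponents is even and positive. For odd m both factors are odd and anticommute, so m ↦ n - m changes
the sign of the summand and the sum is its own negative. -/
theorem trace_pathSum_boundary {n : ℕ} (hn : Even n) :
    (pathSum (fun w : Fin (n + 1) → glFin => boundary w) : Matrix (Fin N) (Fin N) _).trace = 0 := by
  rw [pathSum_boundary_eq, Matrix.trace_sum]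
  simp only [Nat.add_sub_cancel]
  rw [Finset.sum_congr rfl fun m hm =>
    trace_neg_generic_pow_mul n m (Nat.lt_succ_iff.1 (Finset.mem_range.1 hm))]
  -- Here tr X⁰ = N is not zero; the sum is -N · N + N · N.
  by_cases h0 : n = 0
  · subst h0
    simp
  rw [trace_generic_pow_even hn h0]
  set f : ℕ → ExteriorAlgebra ℂ glFin := fun m =>
    (-1) ^ m * (-(N • 0) + (generic N ^ m).trace * (generic N ^ (n - m)).trace) with hf
  have hanti : ∀ m ∈ Finset.range (n + 1), f (n + 1 - 1 - m) = -f m := by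
    intro m hm
    have hmn : m ≤ n := Nat.lt_succ_iff.1 (Finset.mem_range.1 hm)
    simp only [hf, Nat.add_sub_cancel, smul_zero, neg_zero, zero_add, Nat.sub_sub_self hmn]
    rcases Nat.even_or_odd m with he | ho
    · have he' : Even (n - m) := (Nat.even_sub hmn).2 (by tauto)
      have hz : (generic N ^ m).trace = 0 ∨ (generic N ^ (n - m)).trace = 0 := by
        by_cases hm0 : m = 0
        · exact .inr (trace_generic_pow_even he' (by omega))
        · exact .inl (trace_generic_pow_even he hm0)
      rcases hz with hz | hz <;> simp [hz]
    · have ho' : Odd (n - m) := by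
        rw [← Nat.not_even_iff_odd] at ho ⊢
        rw [Nat.even_sub hmn]
        tauto
      rw [trace_generic_pow_mul m (n - m), (ho.mul ho').neg_one_pow, ho.neg_one_pow,
        ho'.neg_one_pow]
      simp
  have h := Finset.sum_range_reflect f (n + 1)
  rw [Finset.sum_congr rfl hanti, Finset.sum_neg_distrib] at h
  exact eq_zero_of_eq_neg_self h.symm

open Classical in
theorem sum_boundary_units_isClosedPath {n : ℕ} (hn : Even n) :
    ∑ I : Fin (n + 1) → Fin N × Fin N, (if IsClosedPath I then boundary (units I) else 0) = 0 := by
  refine Eq.trans ?_ (trace_pathSum_boundary (N := N) hn)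
  simp only [Matrix.trace, Matrix.diag, pathSum]
  conv_rhs => rw [Finset.sum_comm]
  refine Finset.sum_congr rfl fun I _ => ?_
  rw [← Finset.sum_smul, sum_unitsProd_entry, trace_unitsProd]
  split_ifs <;> simp

end Paths

/-! ### Reorderings of the full cycle -/

section Rotation

theorem sign_eq_one_of_add_one {n : ℕ} (hn : Even n) (σ : Equiv.Perm (Fin (n + 1)))
    (h : ∀ t, σ (t + 1) = σ t + 1) : Equiv.Perm.sign σ = 1 := by
  have h2 : ∀ t, σ t = t + σ 0 := by
    intro t
    induction t using Fin.induction with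
    | zero => rw [zero_add]
    | succ t ih => rw [← Fin.coeSucc_eq_succ, h, ih, add_right_comm]
  have h3 : ∀ (r : ℕ) (t : Fin (n + 1)), (σ ^ r) t = t + r • σ 0 := by
    intro r t
    induction r with
    | zero => simp
    | succ r ih => rw [pow_succ', Equiv.Perm.mul_apply, ih, h2 (t + _), succ_nsmul, add_assoc]
  have h4 : σ ^ (n + 1) = 1 := by
    ext t
    rw [h3, show (n + 1) • σ 0 = 0 by simpa using card_nsmul_eq_zero (x := σ 0)]
    simp
  have h5 := congrArg Equiv.Perm.sign h4
  rw [map_pow, map_one] at h5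
  rcases Int.units_eq_one_or (Equiv.Perm.sign σ) with hs | hs
  · exact hs
  · rw [hs, hn.add_one.neg_one_pow] at h5
    exact absurd h5 (by decide)

/-- The closed path through all elements of `Fin (n + 1)`. -/
def fullCycle (n : ℕ) (t : Fin (n + 1)) : Fin (n + 1) × Fin (n + 1) := (t, t + 1)

theorem isClosedPath_fullCycle (n : ℕ) : IsClosedPath (fullCycle n) :=
  ⟨fun _ => Fin.coeSucc_eq_succ, Fin.last_add_one n⟩

open Classical in
-- The edges of the full cycle have distinct starting points, so a reordering is a closed path only
-- if it satisfies σ(t + 1) = σ(t) + 1. All such reorderings count with sign +1, and the identity is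
-- one of them.
theorem alternate_isClosedPath_fullCycle_ne_zero {n : ℕ} (hn : Even n) :
    alternate (fun I : Fin (n + 1) → Fin (n + 1) × Fin (n + 1) =>
      if IsClosedPath I then (1 : ℤ) else 0) (fullCycle n) ≠ 0 := by
  refine (Finset.sum_pos' (fun σ _ => ?_) ⟨1, Finset.mem_univ _, ?_⟩).ne'
  · simp only
    split_ifs with h
    · rw [sign_eq_one_of_add_one hn σ]
      · simp
      · intro t
        induction t using Fin.lastCases with
        | last => rw [Fin.last_add_one]; exact h.2.symm
        | cast t => rw [Fin.coeSucc_eq_succ]; exact (h.1 t).symm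
    · simp
  · simp [isClosedPath_fullCycle]

end Rotation

/-! ### The cycle of closed paths and the conclusion -/

theorem exists_isCycle_sum_alternate_trace_ne_zero {n : ℕ} (hn : Even n) :
    ∃ (m : ℕ) (A : Fin m → Fin (n + 1) → glFin), IsCycle A ∧
      ∑ i, alternate (fun B : Fin (n + 1) → InfMat ℂ => trace id (List.ofFn B).prod)
        (fun j => (A i j : InfMat ℂ)) ≠ 0 := by
  classical
  let α := {I : Fin (n + 1) → Fin (n + 1) × Fin (n + 1) // IsClosedPath I}
  refine ⟨Fintype.card α, fun i => units ((Fintype.equivFin α).symm i).1, ?_, ?_⟩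
  · rw [IsCycle, (Fintype.equivFin α).symm.sum_comp fun I : α => boundary (units I.1),
      ← sum_boundary_units_isClosedPath (N := n + 1) hn, ← Finset.sum_filter]
    exact (Finset.sum_subtype _ (by simp) fun I => boundary (units I)).symm
  · rw [(Fintype.equivFin α).symm.sum_comp fun I : α => alternate
      (fun B : Fin (n + 1) → InfMat ℂ => trace id (List.ofFn B).prod)
        (fun j => (units I.1 j : InfMat ℂ))]
    -- The trace of a product of matrix units is the indicator of closed paths, so the pairing
    -- becomes an integer sum of the symmetrized form.
    have hval : ∀ I : Fin (n + 1) → Fin (n + 1) × Fin (n + 1),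
        alternate (fun B : Fin (n + 1) → InfMat ℂ => trace id (List.ofFn B).prod)
          (fun j => (units I j : InfMat ℂ)) =
        ((alternate (fun J => if IsClosedPath J then (1 : ℤ) else 0) I : ℤ) : ℂ) := by
      intro I
      rw [alternate, alternate, Int.cast_sum]
      refine Finset.sum_congr rfl fun σ _ => ?_
      have := trace_unitsProd (I ∘ σ)
      rw [unitsProd] at this
      change _ • trace id (List.ofFn fun t => (units (I ∘ σ) t : InfMat ℂ)).prod = _
      rw [this]
      split_ifs <;> simp
    simp only [hval]
    rw [← Int.cast_sum, Int.cast_ne_zero]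
    have h := sum_mul_alternate_ne_zero _ _ (alternate_isClosedPath_fullCycle_ne_zero hn)
    simp only [ite_mul, one_mul, zero_mul] at h
    rw [← Finset.sum_filter] at h
    rwa [Finset.sum_subtype _ (p := IsClosedPath) (by simp)] at h

theorem theorem4p3p4 (k : ℕ) (hk : 1 ≤ k) :
    (∃ (m : ℕ) (A : Fin m → Fin (2 * k - 1) → glFin),
      IsCycle A ∧ ∑ i, PsiContracted k (A i) ≠ 0) ∧
    (∀ (m : ℕ) (A : Fin m → Fin (2 * k - 1) → glFin),
      ∑ i, PsiContracted k (A i) =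
        -(2 * k + 1 : ℂ) * InfMat.trace id
          (∑ i, alternate (fun B : Fin (2 * k - 1) → InfMat ℂ => (List.ofFn B).prod)
            fun j => (A i j : InfMat ℂ))) ∧
    PsiContracted 1 (fun _ => glFin.E11) = -3 := by
  refine ⟨?_, ?_, ?_⟩
  · obtain ⟨n, rfl⟩ := Nat.exists_eq_add_of_le' hk
    obtain ⟨m, A, hA, h⟩ := exists_isCycle_sum_alternate_trace_ne_zero (even_two_mul n)
    refine ⟨m, A, hA, ?_⟩
    rw [Finset.sum_congr rfl fun i _ => PsiContracted_succ n (A i), ← Finset.mul_sum]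
    exact mul_ne_zero (neg_ne_zero.2 (by exact_mod_cast Nat.succ_ne_zero (2 * (n + 1)))) h
  · obtain ⟨n, rfl⟩ := Nat.exists_eq_add_of_le' hk
    intro m A
    rw [Finset.sum_congr rfl fun i _ => PsiContracted_succ n (A i), ← Finset.mul_sum]
    exact congrArg _ (trace_sum_alternate_prod (n := 2 * n) Finset.univ A).symm
  · refine (PsiContracted_succ 0 fun _ => glFin.E11).trans ?_
    have h : trace id (glFin.E11 : InfMat ℂ) = 1 := by
      rw [glFin.E11_eq]
      exact (InfMat.trace_unit 0 0).trans (if_pos rfl)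
    have h' : alternate (fun B : Fin (2 * 0 + 1) → InfMat ℂ => trace id (List.ofFn B).prod)
        (fun _ => (glFin.E11 : InfMat ℂ)) = 1 := by
      simp [alternate, h]
    rw [h']
    norm_num
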